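/- Let $\Omega$ be an alphabet of $b\ge 2$ symbols and let $\lambda>0$ be a real number; if $b=2$, assume moreover $\lambda\le\ln 2$. For a sequence $x\in\Omega^{\mathbb N}$ (positions numbered from $1$), $i\ge 0$ and $k\ge 1$, let $Z^\lambda_{i,k}(x)$ be $b^{-k}$ times the number of words $w\in\Omega^k$ that occur exactly $i$ times in $x[1\ldots\lfloor\lambda b^k\rfloor+k-1]$ (overlapping occurrences are counted). Call $x$ *$\lambda$-Poisson generic* if $\lim_{k\to\infty}Z^\lambda_{i,k}(x)=e^{-\lambda}\lambda^i/i!$ for every $i\ge 0$. A *cyclic de Bruijn word of order $n$* is a word of length $b^n$ such that every word of length $n$ occurs exactly once in the circular word it determines. An *infinite de Bruijn sequence* is a sequence $A\in\Omega^{\mathbb N}$ such that, for every $k\ge1$, $A[1\ldots b^k]$ is a cyclic de Bruijn word of order $k$ if $b\ge 3$, and $A[1\ldots 2^{2k-1}]$ is a cyclic de Bruijn word of order $2k-1$ if $b=2$. **Construction.** Put $p_i=e^{-\lambda}\lambda^i/i!$ and $g(k)=\lceil k/2\rceil$. Fix an infinite de Bruijn sequence $A$ and start with the empty word $x_0$.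 At step $k=1,2,\ldots$, for $i\ge1$ and $1\le j\le g(k)$, let $a^{(k)}_{i,j}$ be the $j$-th base-$b$ digit after the point of $p_i$ if $k=1$, and of $\frac{b-1}{b}p_i$ if $k\ge 2$. (The expansion used is the one not ending in an infinite tail of digits $b-1$.) For all $i\ge 1$ and $1\le j\le g(k)$, select $a^{(k)}_{i,j}$ segments of $A[1\ldots b^k]$ of length $b^{k-j}$, labelled $i$, so that the positions of all the segments selected at this and earlier steps are pairwise disjoint. At step $1$, and at every step if $b=2$, the segments must moreover be selected from left to right without gaps: after the step, every position that precedes a segment selected at the step is covered by a selected segment. Then $x_k$ is obtained by appending to $x_{k-1}$, for each segment selected at step $k$, taken in any order, the concatenation of $i$ copies of the segment, where $i$ is its label. **Claim.** (1) An infinite de Bruijn sequence over $\Omega$ exists. (2) The construction can always be carried out: any choices made in finitely many initial steps in accordance with the rules can be continued to choices for all steps in accordance with the rules. (3) For every infinite de Bruijn sequence $A$ and all choices in accordance with the rules, the lengths $|x_k|$ tend to infinity, and the infinite sequence $x\in\Omega^{\mathbb N}$ that has every $x_k$ as a prefix is $\lambda$-Poisson generic. -/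

import Mathlib

open Filter Topology

namespace PoissonGeneric

section Words

variable {Ω : Type*}

/-- The prefix `x[1...n]` of an infinite sequence. Positions are numbered from `0` here, so
`x m` is the symbol in position `m + 1`. -/
def pref (x : ℕ → Ω) (n : ℕ) : List Ω := (List.range n).map x

/-- The segment of `x` of length `n` whose first symbol is `x s`. -/
def segment (x : ℕ → Ω) (s n : ℕ) : List Ω := (List.range n).map fun m => x (s + m)

/-- The number `|v|_w` of (possibly overlapping) occurrences of `w` in `v`. -/
def occ [DecidableEq Ω] (v w : List Ω) : ℕ :=
  ((Finset.range (v.length + 1 - w.length)).filter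
    fun m => (v.drop m).take w.length = w).card

variable [Fintype Ω]

/-- `Z^λ_{i,k}(x)`: the proportion of words of length `k` that occur exactly `i` times in
`x[1...⌊λ b^k⌋ + k - 1]`, where `b` is the size of the alphabet (and `k ≥ 1`). -/
noncomputable def Z [DecidableEq Ω] (lam : ℝ) (i k : ℕ) (x : ℕ → Ω) : ℝ :=
  ((Finset.univ.filter fun w : Fin k → Ω =>
      occ (pref x (⌊lam * (Fintype.card Ω : ℝ) ^ k⌋₊ + k - 1)) (List.ofFn w) = i).card : ℝ)
    / (Fintype.card Ω : ℝ) ^ k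

/-- `p_i = e^{-λ} λ^i / i!`. -/
noncomputable def poissonMass (lam : ℝ) (i : ℕ) : ℝ :=
  Real.exp (-lam) * lam ^ i / (Nat.factorial i : ℝ)

/-- The sequence `x` is `λ`-Poisson generic. -/
def IsPoissonGeneric [DecidableEq Ω] (lam : ℝ) (x : ℕ → Ω) : Prop :=
  ∀ i : ℕ, Tendsto (fun k : ℕ => Z lam i k x) atTop (𝓝 (poissonMass lam i))

/-- Cyclic de Bruijn word of order `n`: it has length `b^n`, and each word of length `n` occurs
exactly once in the circular word that it determines. -/
def IsCyclicDeBruijn (n : ℕ) (w : List Ω) : Prop :=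
  w.length = Fintype.card Ω ^ n ∧
    ∀ v : Fin n → Ω, ∃! s : ℕ, s < Fintype.card Ω ^ n ∧ (w.rotate s).take n = List.ofFn v

/-- Infinite de Bruijn sequence over an alphabet of `b ≥ 2` symbols: every prefix of length `b^k`
(for `b = 2`, every prefix of length `2^(2k-1)`), `k ≥ 1`, is a cyclic de Bruijn word. -/
def IsInfiniteDeBruijn (A : ℕ → Ω) : Prop :=
  if Fintype.card Ω = 2 then
    ∀ k : ℕ, 1 ≤ k → IsCyclicDeBruijn (2 * k - 1) (pref A (2 ^ (2 * k - 1)))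
  else
    ∀ k : ℕ, 1 ≤ k → IsCyclicDeBruijn k (pref A (Fintype.card Ω ^ k))

end Words

section Construction

/-- The `j`-th digit (`j ≥ 1`) of `y ∈ [0, 1]` in base `b`: for `y < 1` in the expansion that does
not end in an infinite tail of `(b-1)`'s, and for `y = 1` in the expansion `0.(b-1)(b-1)...`. -/
noncomputable def digit (b : ℕ) (y : ℝ) (j : ℕ) : ℕ :=
  if y = 1 then b - 1 else ⌊y * (b : ℝ) ^ j⌋₊ % b

/-- `g(k) = ⌈k / 2⌉`. -/
def g (k : ℕ) : ℕ := (k + 1) / 2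

/-- The number of blocks of relative length `b^{-j}` that step `k` of the construction selects
in order to repeat each of them `i` times. This is a digit of `p_i` at step `1`, and a digit of
`((b-1)/b) p_i` at the steps `k ≥ 2`. There is no step `0`. -/
noncomputable def blockCount (b : ℕ) (p : ℕ → ℝ) (k i j : ℕ) : ℕ :=
  if 1 ≤ k ∧ 1 ≤ i ∧ 1 ≤ j ∧ j ≤ g k then
    if k = 1 then digit b (p i) j else digit b (((b : ℝ) - 1) / (b : ℝ) * p i) j
  else 0

/-- A block selected at a step `k`: its first position is `start`, its relative length with
respect to the first `b^k` positions is `b^{-scale}`, and it is to be repeated `mult` times. -/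
structure Block where
  mult : ℕ
  scale : ℕ
  start : ℕ

/-- Absolute length of a block selected at step `k`. -/
def Block.len (b k : ℕ) (B : Block) : ℕ := b ^ (k - B.scale)

/-- The positions occupied by a block selected at step `k`. -/
def Block.positions (b k : ℕ) (B : Block) : Finset ℕ :=
  Finset.Ico B.start (B.start + B.len b k)

/-- `S k` is the list of the blocks selected at step `k`, in the order in which their runs are
appended to the output. `ValidStep b p S k` says that step `k` follows the rules, given the blocks
selected at the earlier steps. -/
structure ValidStep (b : ℕ) (p : ℕ → ℝ) (S : ℕ → List Block) (k : ℕ) : Prop where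
  /-- the prescribed number of blocks of each kind is selected -/
  count : ∀ i j : ℕ,
    (S k).countP (fun B => decide (B.mult = i ∧ B.scale = j)) = blockCount b p k i j
  /-- the blocks lie in the first `b^k` positions -/
  inside : ∀ B ∈ S k, B.start + B.len b k ≤ b ^ k
  /-- blocks selected at this step do not overlap each other -/
  disjoint_self : (S k).Pairwise fun B C => Disjoint (B.positions b k) (C.positions b k)
  /-- blocks selected at this step do not overlap those selected earlier -/
  disjoint_earlier : ∀ l < k, ∀ B ∈ S l, ∀ C ∈ S k,
    Disjoint (B.positions b l) (C.positions b k)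
  /-- at step `1`, and for `b = 2` at every step, no gap is left before a selected block -/
  no_gaps : (k = 1 ∨ b = 2) → ∀ B ∈ S k, ∀ m < B.start,
    ∃ l ≤ k, ∃ C ∈ S l, m ∈ C.positions b l

variable {Ω : Type*} [Fintype Ω]

/-- The run of a block selected at step `k`: `mult` consecutive copies of the segment of `A`
at the positions of the block. -/
def run (A : ℕ → Ω) (k : ℕ) (B : Block) : List Ω :=
  (List.replicate B.mult (segment A B.start (B.len (Fintype.card Ω) k))).flatten

/-- The output `x_k` after step `k`. -/
def output (A : ℕ → Ω) (S : ℕ → List Block) : ℕ → List Ω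
  | 0 => []
  | k + 1 => output A S k ++ (S (k + 1)).flatMap (run A (k + 1))

/-- `x` is the infinite word which is the limit of the finite words `x_k`: each of them is a
prefix of `x`, and their lengths are unbounded. -/
def IsLimitOutput (A : ℕ → Ω) (S : ℕ → List Block) (x : ℕ → Ω) : Prop :=
  (∀ k : ℕ, output A S k = pref x (output A S k).length) ∧
    Tendsto (fun k : ℕ => (output A S k).length) atTop atTop

end Construction

end PoissonGeneric

/-!
The proof has three independent parts.

*Infinite de Bruijn sequences.* A cyclic de Bruijn word of order `m + 1` is a closed trail through
all edges of the graph on the words of length `m`. A de Bruijn word of order `n` is a simple path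
of edges there, and by Euler's theorem with a prescribed beginning (`exists_closed_trail`) it
extends to such a trail as soon as the other edges connect the graph. Locally, the edges
`a τ → τ d` with a fixed `τ` form a complete bipartite graph. For `m = n` the word removes a
perfect matching from it, which leaves it connected if `b ≥ 3`; for `m = n + 1` the word removes a
single edge, and this is harmless for every `b ≥ 2`. Limits of these extensions give the sequence.

*Continuing the construction.* The blocks of multiplicity `i` prescribed for step `k` have total
length at most `p i * layer b k`, where `layer b k` is the number of positions that the step makes
available (`stepLen_le`). As the `p i` sum to `1`, the new blocks can be placed one after another,
behind all the earlier ones and, where gaps are forbidden, from the first uncovered position.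

*Genericity.* Fix `k` and call an occurrence of a word `w` of length `k` in the output inner if it
lies in a single copy of a block selected up to step `k`. No word of length `k` occurs twice in
these blocks (`window_injective_on_rooms`): they lie in a de Bruijn word of order `k`, or, for
`b = 2` and `k` even, in one of order `k - 1`, because without gaps the blocks fill at most
`(1 - e^{-λ}) 2^k ≤ 2^(k-1)` positions; this is where `λ ≤ ln 2` enters. So for `i ≥ 1` the words
with exactly `i` inner occurrences correspond to the positions inside blocks of multiplicity `i`,
and their proportion is at most `p i` and tends to `p i` (`tendsto_roomCount_div`). By Tannery's
theorem the inner occurrences number `λ b^k - o(b^k)`, since `λ` is the mean of the Poisson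
distribution. But `⌊λ b^k⌋` is the number of all occurrences that are counted in `Z`, so only
`o(b^k)` words have an occurrence that is not inner, and these do not affect the limit proportions
(`tendsto_card_fiber_div`).
-/

namespace PoissonGeneric

/-! ### Closed trails through prescribed initial edges -/

section Euler

variable {E V : Type*} [DecidableEq E] {src tgt : E → V}

/-- Composing with a transposition of a point `e` of a cycle and a point `f` outside merges the
cycle of `f` into the cycle of `e`. -/
theorem sameCycle_mul_swap [Finite E] {π : Equiv.Perm E} {e f : E} (hf : ¬ π.SameCycle e f) {x : E}
    (hx : π.SameCycle e x) : (π * Equiv.swap e f).SameCycle f x := by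
  set ρ := π * Equiv.swap e f with hρ
  have hρf : ρ f = π e := by simp [hρ]
  have key : ∀ j : ℕ, ρ.SameCycle f ((π ^ (j + 1)) e) := by
    intro j
    induction j with
    | zero => simpa [hρf] using (Equiv.Perm.SameCycle.refl ρ f).apply_right
    | succ j ih =>
      rw [pow_succ', Equiv.Perm.mul_apply]
      by_cases h1 : (π ^ (j + 1)) e = e
      · rw [h1, ← hρf]
        exact (Equiv.Perm.SameCycle.refl ρ f).apply_right
      · have h2 : (π ^ (j + 1)) e ≠ f := fun h => hf ⟨(j + 1 : ℕ), by rw [zpow_natCast, h]⟩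
        have h3 : ρ ((π ^ (j + 1)) e) = π ((π ^ (j + 1)) e) := by
          rw [hρ, Equiv.Perm.mul_apply, Equiv.swap_apply_of_ne_of_ne h1 h2]
        rw [← h3]
        exact ih.apply_right
  obtain ⟨i, hi, -, hix⟩ := hx.exists_pow_eq''
  obtain ⟨j, rfl⟩ := Nat.exists_eq_succ_of_ne_zero hi.ne'
  rw [← hix]
  exact key j

/-- A permutation that sends each edge to a successor of it can be changed so that it follows a
given simple path of edges. -/
theorem exists_perm_follow_path (hbal : ∃ π : Equiv.Perm E, ∀ e, src (π e) = tgt e) {N : ℕ}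
    {h : ℕ → E} (hinj : Set.InjOn h (Set.Iio N))
    (hpath : ∀ t, t + 1 < N → src (h (t + 1)) = tgt (h t)) (n : ℕ) (hn : n < N) :
    ∃ π : Equiv.Perm E, (∀ e, src (π e) = tgt e) ∧ ∀ t < n, π (h t) = h (t + 1) := by
  induction n with
  | zero => exact hbal.imp fun π hπ => ⟨hπ, by simp⟩
  | succ n ih =>
    obtain ⟨π, hπ, hfol⟩ := ih (by omega)
    set y := π.symm (h (n + 1)) with hy
    have hπy : π y = h (n + 1) := by simp [hy]
    have hty : tgt y = tgt (h n) := by rw [← hπ y, hπy, hpath n hn]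
    refine ⟨π * Equiv.swap (h n) y, fun e => ?_, fun t ht => ?_⟩
    · rw [Equiv.Perm.mul_apply, hπ]
      by_cases h1 : e = h n
      · rw [h1, Equiv.swap_apply_left, hty]
      by_cases h2 : e = y
      · rw [h2, Equiv.swap_apply_right, hty]
      rw [Equiv.swap_apply_of_ne_of_ne h1 h2]
    · rw [Equiv.Perm.mul_apply]
      rcases Nat.lt_succ_iff_lt_or_eq.mp ht with ht | rfl
      · have h1 : h t ≠ h n := fun hh => by
          have := hinj (show t < N by omega) (show n < N by omega) hh
          omega
        have h2 : h t ≠ y := fun hh => by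
          have h3 := hfol t ht
          rw [hh, hπy] at h3
          have := hinj (show n + 1 < N by omega) (show t + 1 < N by omega) h3
          omega
        rw [Equiv.swap_apply_of_ne_of_ne h1 h2, hfol t ht]
      · rw [Equiv.swap_apply_left, hπy]

/-- Euler's theorem with a prescribed beginning. In a balanced finite directed multigraph (the
existence of `π` in `hbal` is the balance condition), a simple path `h 0, …, h (N - 1)` of edges
extends to a closed trail through all edges, provided that the edges off the path connect all
vertices. The closed trail is encoded by the permutation sending each edge to the next one. -/
theorem exists_closed_trail [Fintype E] (hbal : ∃ π : Equiv.Perm E, ∀ e, src (π e) = tgt e) {N : ℕ}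
    (hN : 0 < N) {h : ℕ → E} (hinj : Set.InjOn h (Set.Iio N))
    (hpath : ∀ t, t + 1 < N → src (h (t + 1)) = tgt (h t))
    (hconn : ∀ P : V → Prop, (∀ e, (∀ t < N, h t ≠ e) → (P (src e) ↔ P (tgt e))) →
      P (tgt (h (N - 1))) → ∀ v, P v) :
    ∃ π : Equiv.Perm E, (∀ e, src (π e) = tgt e) ∧ (∀ t, t + 1 < N → π (h t) = h (t + 1)) ∧
      ∀ e, π.SameCycle (h 0) e := by
  classical
  let C : Finset (Equiv.Perm E) := Finset.univ.filter fun π =>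
    (∀ e, src (π e) = tgt e) ∧ ∀ t, t + 1 < N → π (h t) = h (t + 1)
  have hC : C.Nonempty := by
    obtain ⟨π, h1, h2⟩ := exists_perm_follow_path hbal hinj hpath (N - 1) (by omega)
    exact ⟨π, by simpa [C] using ⟨h1, fun t ht => h2 t (by omega)⟩⟩
  -- Choose the permutation whose cycle through `h 0` is as large as possible.
  obtain ⟨π, hπC, hmax⟩ := C.exists_max_image
    (fun π => (Finset.univ.filter fun e => π.SameCycle (h 0) e).card) hC
  simp only [C, Finset.mem_filter, Finset.mem_univ, true_and] at hπC hmax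
  obtain ⟨hsrc, hfol⟩ := hπC
  refine ⟨π, hsrc, hfol, ?_⟩
  have hpathO : ∀ t < N, π.SameCycle (h 0) (h t) := by
    intro t
    induction t with
    | zero => intro _; exact .refl _ _
    | succ t ih =>
      intro ht
      rw [← hfol t ht]
      exact (ih (by omega)).apply_right
  -- By maximality no swap of two free edges with the same target enlarges that cycle.
  have hclosed : ∀ e f, (∀ t, t + 1 < N → h t ≠ e) → π.SameCycle (h 0) e → tgt f = tgt e →
      π.SameCycle (h 0) f := by
    intro e f he hOe hef
    by_contra hOf
    have hf : ∀ t, t + 1 < N → h t ≠ f := fun t ht hh => hOf (hh ▸ hpathO t (by omega))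
    have hnot : ¬ π.SameCycle e f := fun hh => hOf (hOe.trans hh)
    have hle := hmax (π * Equiv.swap e f) ⟨fun d => ?_, fun t ht => ?_⟩
    · refine absurd hle (not_le.mpr (Finset.card_lt_card ?_))
      have h0 : (π * Equiv.swap e f).SameCycle f (h 0) := sameCycle_mul_swap hnot hOe.symm
      refine Finset.ssubset_iff_of_subset ?_ |>.mpr ⟨f, ?_, ?_⟩
      · intro x hx
        simp only [Finset.mem_filter, Finset.mem_univ, true_and] at hx ⊢
        exact h0.symm.trans (sameCycle_mul_swap hnot (hOe.symm.trans hx))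
      · simpa using h0.symm
      · simpa using hOf
    · rw [Equiv.Perm.mul_apply, hsrc]
      by_cases h1 : d = e
      · rw [h1, Equiv.swap_apply_left, hef]
      by_cases h2 : d = f
      · rw [h2, Equiv.swap_apply_right, hef]
      rw [Equiv.swap_apply_of_ne_of_ne h1 h2]
    · rw [Equiv.Perm.mul_apply, Equiv.swap_apply_of_ne_of_ne (he t ht) (hf t ht), hfol t ht]
  -- So a vertex with one free incoming edge on the cycle has all its incoming edges on the cycle,
  -- and this property passes in both directions along the edges off the path.
  have hall := hconn (fun v => ∀ f, tgt f = v → π.SameCycle (h 0) f) ?_ ?_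
  · exact fun e => hall _ e rfl
  · intro e he
    have hpre : tgt (π.symm e) = src e := by rw [← hsrc, Equiv.apply_symm_apply]
    constructor
    · intro hv
      refine fun f hf => hclosed e f (fun t ht => he t (by omega)) ?_ hf
      have := (hv _ hpre).apply_right
      rwa [Equiv.apply_symm_apply] at this
    · intro hw
      have hOe := hw e rfl
      rw [← hpre]
      refine fun f hf => hclosed _ f (fun t ht hh => he (t + 1) ht ?_) ?_ hf
      · rw [← hfol t ht, hh, Equiv.apply_symm_apply]
      · rw [← Equiv.Perm.sameCycle_apply_right, Equiv.apply_symm_apply]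
        exact hOe
  · refine fun f hf => hclosed _ f (fun t ht hh => ?_) (hpathO _ (by omega)) hf
    have := hinj (show t < N by omega) (show N - 1 < N by omega) hh
    omega

end Euler

/-! ### Extension of de Bruijn words -/

section Windows

variable {Ω : Type*}

/-- The word of length `k` that occurs in `x` at position `s`, as a function on `Fin k`. -/
def window (x : ℕ → Ω) (k s : ℕ) : Fin k → Ω := fun j => x (s + j)

theorem window_succ_eq_snoc (x : ℕ → Ω) (k s : ℕ) :
    window x (k + 1) s = Fin.snoc (α := fun _ => Ω) (window x k s) (x (s + k)) := by
  funext j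
  refine Fin.lastCases ?_ (fun i => ?_) j <;> simp [window]

theorem window_succ_eq_cons (x : ℕ → Ω) (k s : ℕ) :
    window x (k + 1) s = Fin.cons (α := fun _ => Ω) (x s) (window x k (s + 1)) := by
  funext j
  refine Fin.cases ?_ (fun i => ?_) j
  · simp [window]
  · simp only [window, Fin.cons_succ, Fin.val_succ]
    congr 1
    omega

theorem apply_eq_of_window_eq {x y : ℕ → Ω} {k s t : ℕ} (h : window x k s = window y k t) {j : ℕ}
    (hj : j < k) : x (s + j) = y (t + j) := congrFun h ⟨j, hj⟩

theorem window_eq_of_le {x y : ℕ → Ω} {k l s t : ℕ} (hkl : k ≤ l)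
    (h : window x l s = window y l t) : window x k s = window y k t :=
  funext fun j => apply_eq_of_window_eq h (j.2.trans_le hkl)

/-- The connectivity hypothesis of `exists_extension_of_connected` in terms of the first symbol,
the middle part and the last symbol of an edge word. -/
theorem transfer_of_init_tail {c : ℕ → Ω} {q : ℕ} {P : (Fin (q + 1) → Ω) → Prop}
    (hP : ∀ e : Fin (q + 2) → Ω, (∀ t, window c (q + 2) t ≠ e) → (P (Fin.init e) ↔ P (Fin.tail e)))
    (a : Ω) (τ : Fin q → Ω) (d : Ω)
    (h : ∀ t, c t = a → window c q (t + 1) = τ → c (t + 1 + q) ≠ d) :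
    P (Fin.cons (α := fun _ => Ω) a τ) ↔ P (Fin.snoc (α := fun _ => Ω) τ d) := by
  have h1 := hP (Fin.cons (α := fun _ => Ω) a (Fin.snoc (α := fun _ => Ω) τ d)) (fun t ht => ?_)
  · rw [Fin.tail_cons, Fin.cons_snoc_eq_snoc_cons, Fin.init_snoc] at h1
    exact h1
  · rw [window_succ_eq_cons, Fin.cons_inj, window_succ_eq_snoc] at ht
    obtain ⟨ha, ht⟩ := ht
    rw [Fin.snoc_inj] at ht
    exact h t ha ht.1 ht.2

theorem take_rotate_pref (A : ℕ → Ω) {n N s : ℕ} (hn : n ≤ N) :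
    ((pref A N).rotate s).take n = List.ofFn fun j : Fin n => A ((s + j) % N) := by
  apply List.ext_getElem
  · simp [pref, hn]
  · intro j h1 h2
    simp [pref, List.getElem_rotate, add_comm]

variable [Fintype Ω]

/-- The infinite periodic sequence `c` is the unrolling of a cyclic de Bruijn word of order `n`:
by counting, injectivity of the windows over one period says that each word occurs once. -/
def IsPeriodicDeBruijn (n : ℕ) (c : ℕ → Ω) : Prop :=
  Function.Periodic c (Fintype.card Ω ^ n) ∧ Set.InjOn (window c n) (Set.Iio (Fintype.card Ω ^ n))

namespace IsPeriodicDeBruijn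

variable {n : ℕ} {c : ℕ → Ω}

theorem exists_window_eq (hc : IsPeriodicDeBruijn n c) (v : Fin n → Ω) :
    ∃ t < Fintype.card Ω ^ n, window c n t = v := by
  classical
  have := Finset.surj_on_of_inj_on_of_card_le (s := Finset.range (Fintype.card Ω ^ n))
    (t := (Finset.univ : Finset (Fin n → Ω))) (fun t _ => window c n t) (by simp)
    (fun s t hs ht h => hc.2 (by simpa using hs) (by simpa using ht) h) (by simp) v (by simp)
  obtain ⟨t, ht, h⟩ := this
  exact ⟨t, by simpa using ht, h.symm⟩

theorem window_mod (hc : IsPeriodicDeBruijn n c) (k s : ℕ) :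
    window c k (s % Fintype.card Ω ^ n) = window c k s := by
  funext j
  simp only [window]
  rw [← hc.1.map_mod_nat, ← hc.1.map_mod_nat (s + j), Nat.mod_add_mod]

variable [Nonempty Ω]

/-- Two positions with the same window have the same future. -/
theorem apply_add_eq (hc : IsPeriodicDeBruijn n c) {s t : ℕ} (h : window c n s = window c n t)
    (j : ℕ) : c (s + j) = c (t + j) := by
  have hpos : 0 < Fintype.card Ω ^ n := pow_pos Fintype.card_pos n
  have h1 : s % Fintype.card Ω ^ n = t % Fintype.card Ω ^ n := by
    refine hc.2 (Nat.mod_lt _ hpos) (Nat.mod_lt _ hpos) ?_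
    rw [hc.window_mod, hc.window_mod, h]
  have h2 := hc.window_mod (j + 1) s
  rw [h1, hc.window_mod (j + 1) t] at h2
  exact (apply_eq_of_window_eq h2 (Nat.lt_succ_self j)).symm

/-- Two positions followed by the same window carry the same symbol. -/
theorem apply_eq_of_succ (hc : IsPeriodicDeBruijn n c) {s t : ℕ}
    (h : window c n (s + 1) = window c n (t + 1)) : c s = c t := by
  have hpos : 0 < Fintype.card Ω ^ n := pow_pos Fintype.card_pos n
  have h1 := hc.apply_add_eq h (Fintype.card Ω ^ n - 1)
  rwa [show s + 1 + (Fintype.card Ω ^ n - 1) = s + Fintype.card Ω ^ n by omega,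
    show t + 1 + (Fintype.card Ω ^ n - 1) = t + Fintype.card Ω ^ n by omega, hc.1, hc.1] at h1

/-- If removing the transitions of `c` does not disconnect the graph on the words of length `m`,
then `c` extends to a de Bruijn word of order `m + 1`. -/
theorem exists_extension_of_connected (hc : IsPeriodicDeBruijn n c) {m : ℕ} (hnm : n ≤ m + 1)
    (hconn : ∀ P : (Fin m → Ω) → Prop,
      (∀ e : Fin (m + 1) → Ω, (∀ t, window c (m + 1) t ≠ e) → (P (Fin.init e) ↔ P (Fin.tail e))) →
        P (window c m 0) → ∀ v, P v) :
    ∃ c' : ℕ → Ω, IsPeriodicDeBruijn (m + 1) c' ∧ ∀ t < Fintype.card Ω ^ n, c' t = c t := by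
  classical
  have hpos : 0 < Fintype.card Ω ^ n := pow_pos Fintype.card_pos n
  have hinit : ∀ t, (Fin.init (window c (m + 1) t) : Fin m → Ω) = window c m t := fun t => by
    rw [window_succ_eq_snoc, Fin.init_snoc]
  have htail : ∀ t, (Fin.tail (window c (m + 1) t) : Fin m → Ω) = window c m (t + 1) := fun t => by
    rw [window_succ_eq_cons, Fin.tail_cons]
  -- The rotation of the edge words witnesses that the de Bruijn graph is balanced.
  obtain ⟨π, hsrc, hfol, hcyc⟩ := exists_closed_trail (E := Fin (m + 1) → Ω)
    (src := fun e => (Fin.init e : Fin m → Ω)) (tgt := fun e => (Fin.tail e : Fin m → Ω))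
    ⟨Equiv.arrowCongr (finRotate (m + 1)).symm (Equiv.refl Ω), fun e => by
      funext j
      simp [Fin.init, Fin.tail, Equiv.arrowCongr]⟩ hpos (h := window c (m + 1))
    (fun s hs t ht h => hc.2 hs ht (window_eq_of_le hnm h))
    (fun t _ => by simp only [hinit, htail])
    (fun P hP h0 => hconn P (fun e he => hP e fun t _ => he t) (by
      simp only [htail] at h0
      rw [Nat.sub_add_cancel hpos, ← hc.window_mod, Nat.mod_self] at h0
      exact h0))
  set e₀ := window c (m + 1) 0 with he₀
  let c' : ℕ → Ω := fun t => (π ^ t) e₀ 0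
  have hc' : ∀ t, window c' (m + 1) t = (π ^ t) e₀ := by
    have hshift : ∀ (j : ℕ) (hj : j < m + 1) (t : ℕ), (π ^ t) e₀ ⟨j, hj⟩ = c' (t + j) := by
      intro j
      induction j with
      | zero => intro hj t; rfl
      | succ j ih =>
        intro hj t
        have h1 := congrFun (hsrc ((π ^ t) e₀)) ⟨j, by omega⟩
        simp only [Fin.init, Fin.tail, ← Equiv.Perm.mul_apply, ← pow_succ'] at h1
        have h2 := ih (by omega) (t + 1)
        rw [show t + (j + 1) = t + 1 + j by omega, ← h2]
        exact h1.symm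
    intro t
    funext j
    exact (hshift j j.2 t).symm
  have hon : π.IsCycleOn ((Finset.univ : Finset (Fin (m + 1) → Ω)) : Set (Fin (m + 1) → Ω)) :=
    ⟨by simp [Set.bijOn_univ],
      fun x _ y _ => (hcyc x).symm.trans (hcyc y)⟩
  have hcard : (Finset.univ : Finset (Fin (m + 1) → Ω)).card = Fintype.card Ω ^ (m + 1) := by simp
  refine ⟨c', ⟨fun t => ?_, fun s hs t ht h => ?_⟩, fun t ht => ?_⟩
  · have h1 := (hon.pow_apply_eq_pow_apply (Finset.mem_univ e₀) (m := t + Fintype.card Ω ^ (m + 1))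
      (n := t)).mpr (by rw [hcard]; simp [Nat.ModEq])
    exact congrFun h1 0
  · rw [hc', hc'] at h
    have h1 := (hon.pow_apply_eq_pow_apply (Finset.mem_univ e₀)).mp h
    rw [hcard] at h1
    exact Nat.ModEq.eq_of_lt_of_lt h1 hs ht
  · have h1 : ∀ t < Fintype.card Ω ^ n, (π ^ t) e₀ = window c (m + 1) t := by
      intro t
      induction t with
      | zero => intro _; rfl
      | succ t ih =>
        intro ht
        rw [pow_succ', Equiv.Perm.mul_apply, ih (by omega), hfol t ht]
    simp only [c', h1 t ht]
    simp [window]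

/-- Over at least three symbols a de Bruijn word extends to the next order. For each `τ` of length
`n - 1` the edges off the word form a complete bipartite graph minus a perfect matching between
the words `a τ` and the words `τ d`; this is connected, and the word itself visits every `τ`. -/
theorem exists_extension_succ (hc : IsPeriodicDeBruijn n c) (hb : 3 ≤ Fintype.card Ω) :
    ∃ c' : ℕ → Ω, IsPeriodicDeBruijn (n + 1) c' ∧ ∀ t < Fintype.card Ω ^ n, c' t = c t := by
  classical
  refine hc.exists_extension_of_connected (Nat.le_succ n) fun P hP h0 => ?_
  obtain _ | q := n
  · intro v
    rwa [Subsingleton.elim v (window c 0 0)]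
  have htr := transfer_of_init_tail hP
  have hstep : ∀ t, P (window c (q + 1) t) → P (window c (q + 1) (t + 1)) := by
    intro t ht
    obtain ⟨a, ha⟩ : ∃ a, a ∉ ({c t} : Finset Ω) :=
      Finset.exists_mem_notMem_of_card_lt_card (t := Finset.univ) (by
        rw [Finset.card_univ]; simp; omega) |>.imp fun _ h => h.2
    have ha : c t ≠ a := by simpa [eq_comm] using ha
    obtain ⟨s, -, hs⟩ := hc.exists_window_eq (Fin.cons (α := fun _ => Ω) a (window c q (t + 1)))
    obtain ⟨d, hd⟩ : ∃ d, d ∉ ({c (t + 1 + q), c (s + 1 + q)} : Finset Ω) :=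
      Finset.exists_mem_notMem_of_card_lt_card (t := Finset.univ) (by
        rw [Finset.card_univ]
        exact lt_of_le_of_lt (Finset.card_le_two) (by omega)) |>.imp fun _ h => h.2
    simp only [Finset.mem_insert, Finset.mem_singleton, not_or] at hd
    -- The path `c t τ`, `τ d`, `a τ`, `τ c (t + n)` avoids the edges of the word.
    have h1 := htr (c t) (window c q (t + 1)) d fun r hr hw hrd => by
      have h2 : window c (q + 1) r = window c (q + 1) t := by
        rw [window_succ_eq_cons, window_succ_eq_cons, hr, hw]
      have h3 := hc.apply_add_eq h2 (1 + q)
      rw [← add_assoc, ← add_assoc, hrd] at h3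
      exact hd.1 h3
    have h2 := htr a (window c q (t + 1)) d fun r hr hw hrd => by
      have h2 : window c (q + 1) r = window c (q + 1) s := by
        rw [hs, window_succ_eq_cons, hr, hw]
      have h3 := hc.apply_add_eq h2 (1 + q)
      rw [← add_assoc, ← add_assoc, hrd] at h3
      exact hd.2 h3
    have h3 := htr a (window c q (t + 1)) (c (t + 1 + q)) fun r hr hw hrd => by
      have h2 : window c (q + 1) (r + 1) = window c (q + 1) (t + 1) := by
        rw [window_succ_eq_snoc, window_succ_eq_snoc, hrd, hw]
      exact ha ((hc.apply_eq_of_succ h2).symm.trans hr)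
    rw [window_succ_eq_cons] at ht
    rw [window_succ_eq_snoc]
    exact h3.mp (h2.mpr (h1.mp ht))
  intro v
  obtain ⟨t, -, rfl⟩ := hc.exists_window_eq v
  exact Nat.rec h0 hstep t

/-- Over any alphabet of at least two symbols a de Bruijn word of order `n` extends to order
`n + 2`. Among the words `a τ` with `τ` of length `n`, just one is visited by the word, and
the only edge that the word removes between the `a τ` and the `τ d` starts there. -/
theorem exists_extension_add_two (hc : IsPeriodicDeBruijn n c) (hb : 2 ≤ Fintype.card Ω) :
    ∃ c' : ℕ → Ω, IsPeriodicDeBruijn (n + 2) c' ∧ ∀ t < Fintype.card Ω ^ n, c' t = c t := by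
  classical
  refine hc.exists_extension_of_connected (by omega) fun P hP h0 => ?_
  have htr := transfer_of_init_tail hP
  have hne : ∀ x : Ω, ∃ y, y ≠ x := fun x =>
    Finset.exists_mem_notMem_of_card_lt_card (s := {x}) (t := Finset.univ) (by
      rw [Finset.card_univ]; simp; omega) |>.imp fun _ h => by simpa using h.2
  have hstar : ∀ (t : ℕ) (a : Ω), a ≠ c t → ∀ d,
      P (Fin.cons (α := fun _ => Ω) a (window c n (t + 1))) ↔
        P (Fin.snoc (α := fun _ => Ω) (window c n (t + 1)) d) := fun t a ha d =>
    htr a _ d fun r hr hw _ => ha (hr.symm.trans (hc.apply_eq_of_succ hw))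
  have hvisit : ∀ (t : ℕ) (d : Ω), d ≠ c (t + 1 + n) →
      (P (Fin.cons (α := fun _ => Ω) (c t) (window c n (t + 1))) ↔
        P (Fin.snoc (α := fun _ => Ω) (window c n (t + 1)) d)) := fun t d hd =>
    htr (c t) _ d fun r _ hw hrd => hd (hrd.symm.trans (hc.apply_add_eq hw n))
  have hside : ∀ (t : ℕ) (a : Ω), a ≠ c t → P (window c (n + 1) t) →
      P (Fin.cons (α := fun _ => Ω) a (window c n (t + 1))) := by
    intro t a ha ht
    obtain ⟨d, hd⟩ := hne (c (t + 1 + n))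
    rw [window_succ_eq_cons] at ht
    exact (hstar t a ha d).mpr ((hvisit t d hd).mp ht)
  have hstep : ∀ t, P (window c (n + 1) t) → P (window c (n + 1) (t + 1)) := by
    intro t ht
    obtain ⟨a, ha⟩ := hne (c t)
    rw [window_succ_eq_snoc]
    exact (hstar t a ha _).mp (hside t a ha ht)
  have hall : ∀ t, P (window c (n + 1) t) := fun t => Nat.rec h0 hstep t
  intro v
  obtain ⟨t, ht, htv⟩ := hc.exists_window_eq (Fin.tail v)
  -- Move one period on, so that the position has a predecessor.
  have hpos : 0 < Fintype.card Ω ^ n := pow_pos Fintype.card_pos n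
  obtain ⟨r, hr⟩ : ∃ r, r + 1 = t + Fintype.card Ω ^ n :=
    ⟨t + Fintype.card Ω ^ n - 1, by omega⟩
  have hrv : window c n (r + 1) = Fin.tail v := by
    rw [hr, ← hc.window_mod, Nat.add_mod_right, hc.window_mod, htv]
  rw [← Fin.cons_self_tail v, ← hrv]
  by_cases h : v 0 = c r
  · rw [h, ← window_succ_eq_cons]
    exact hall r
  · exact hside r _ h (hall r)

end IsPeriodicDeBruijn

/-! ### Infinite de Bruijn sequences -/

theorem IsPeriodicDeBruijn.isCyclicDeBruijn [Nonempty Ω] (hb : 2 ≤ Fintype.card Ω) {n : ℕ}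
    {c A : ℕ → Ω} (hc : IsPeriodicDeBruijn n c) (hA : ∀ t < Fintype.card Ω ^ n, A t = c t) :
    IsCyclicDeBruijn n (pref A (Fintype.card Ω ^ n)) := by
  have hpos : 0 < Fintype.card Ω ^ n := pow_pos Fintype.card_pos n
  have hw : ∀ s, ((pref A (Fintype.card Ω ^ n)).rotate s).take n = List.ofFn (window c n s) := by
    intro s
    rw [take_rotate_pref A (Nat.lt_pow_self hb).le]
    congr 1
    funext j
    rw [hA _ (Nat.mod_lt _ hpos), hc.1.map_mod_nat, window]
  refine ⟨by simp [pref], fun v => ?_⟩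
  obtain ⟨t, ht, htv⟩ := hc.exists_window_eq v
  refine ⟨t, ⟨ht, by rw [hw, htv]⟩, fun s ⟨hs, hsv⟩ => ?_⟩
  rw [hw, List.ofFn_inj] at hsv
  exact hc.2 hs ht (hsv.trans htv.symm)

/-- If each term of a chain of sequences is a de Bruijn word that extends the previous one, the
limit has all these words as prefixes. -/
theorem exists_forall_isCyclicDeBruijn (hb : 2 ≤ Fintype.card Ω) (r : ℕ → ℕ) (hr : StrictMono r)
    (h0 : ∃ c : ℕ → Ω, IsPeriodicDeBruijn (r 0) c)
    (hext : ∀ k (c : ℕ → Ω), IsPeriodicDeBruijn (r k) c → ∃ c' : ℕ → Ω,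
      IsPeriodicDeBruijn (r (k + 1)) c' ∧ ∀ t < Fintype.card Ω ^ r k, c' t = c t) :
    ∃ A : ℕ → Ω, ∀ k, IsCyclicDeBruijn (r k) (pref A (Fintype.card Ω ^ r k)) := by
  have : Nonempty Ω := Fintype.card_pos_iff.mp (by omega)
  choose! F hF using hext
  obtain ⟨c₀, hc₀⟩ := h0
  let C : ℕ → ℕ → Ω := fun k => Nat.rec c₀ (fun k c => F k c) k
  have hC : ∀ k, IsPeriodicDeBruijn (r k) (C k) := fun k => by
    induction k with
    | zero => exact hc₀
    | succ k ih => exact (hF k _ ih).1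
  have hmono : ∀ k l, k ≤ l → ∀ t < Fintype.card Ω ^ r k, C l t = C k t := by
    intro k l hkl
    induction l, hkl using Nat.le_induction with
    | base => exact fun _ _ => rfl
    | succ l hkl ih =>
      intro t ht
      rw [← ih t ht]
      exact (hF l _ (hC l)).2 t
        (ht.trans_le (Nat.pow_le_pow_right (by omega) (hr.monotone hkl)))
  have hlt : ∀ t, t < Fintype.card Ω ^ r t := fun t =>
    (Nat.lt_pow_self hb).trans_le (Nat.pow_le_pow_right (by omega) hr.le_apply)
  refine ⟨fun t => C t t, fun k => (hC k).isCyclicDeBruijn hb fun t ht => ?_⟩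
  rcases le_total t k with h | h
  · exact (hmono t k h t (hlt t)).symm
  · exact hmono k t h t ht

theorem exists_isInfiniteDeBruijn (hb : 2 ≤ Fintype.card Ω) :
    ∃ A : ℕ → Ω, IsInfiniteDeBruijn A := by
  have hne : Nonempty Ω := Fintype.card_pos_iff.mp (by omega)
  have hzero : IsPeriodicDeBruijn 0 (fun _ => hne.some : ℕ → Ω) :=
    ⟨fun _ => rfl, fun s hs t ht _ => by simp at hs ht; omega⟩
  unfold IsInfiniteDeBruijn
  split_ifs with h2
  · obtain ⟨c, hc, -⟩ := hzero.exists_extension_of_connected (m := 0) (by omega)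
      fun P _ h0 v => by rwa [Subsingleton.elim v (window _ 0 0)]
    obtain ⟨A, hA⟩ := exists_forall_isCyclicDeBruijn hb (fun k => 2 * k + 1)
      (fun _ _ h => by simpa using h) ⟨c, hc⟩
      (fun k c hc => hc.exists_extension_add_two hb)
    refine ⟨A, fun k hk => ?_⟩
    obtain ⟨k, rfl⟩ := Nat.exists_eq_succ_of_ne_zero (by omega : k ≠ 0)
    have := hA k
    rw [h2] at this
    exact this
  · obtain ⟨A, hA⟩ := exists_forall_isCyclicDeBruijn hb (fun k => k) strictMono_id ⟨_, hzero⟩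
      (fun k c hc => hc.exists_extension_succ (by omega))
    exact ⟨A, fun k _ => hA k⟩

/-- Windows inside the initial de Bruijn word determine their position. -/
theorem IsCyclicDeBruijn.injective_window {A : ℕ → Ω} (hb : 2 ≤ Fintype.card Ω) {n : ℕ}
    (hn : 1 ≤ n) (hA : IsCyclicDeBruijn n (pref A (Fintype.card Ω ^ n))) {s t : ℕ}
    (hs : s + n ≤ Fintype.card Ω ^ n) (ht : t + n ≤ Fintype.card Ω ^ n)
    (h : window A n s = window A n t) : s = t := by
  have hw : ∀ s, s + n ≤ Fintype.card Ω ^ n →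
      ((pref A (Fintype.card Ω ^ n)).rotate s).take n = List.ofFn (window A n s) := by
    intro s hs
    rw [take_rotate_pref A (Nat.lt_pow_self hb).le]
    congr 1
    funext j
    rw [Nat.mod_eq_of_lt (by omega), window]
  exact (hA.2 (window A n s)).unique ⟨by omega, hw s hs⟩ ⟨by omega, by rw [hw t ht, h]⟩

end Windows

/-! ### Digits and the lengths prescribed for a step -/

theorem digit_lt {b : ℕ} (hb : 2 ≤ b) (y : ℝ) (j : ℕ) : digit b y j < b := by
  unfold digit
  split_ifs
  · omega
  · exact Nat.mod_lt _ (by omega)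

theorem sum_digit {b : ℕ} (hb : 2 ≤ b) {y : ℝ} (hy : y < 1) (n : ℕ) :
    ∑ j ∈ Finset.Icc 1 n, digit b y j * b ^ (n - j) = ⌊y * (b : ℝ) ^ n⌋₊ := by
  induction n with
  | zero => simp [Nat.floor_eq_zero.mpr hy]
  | succ n ih =>
    rw [Finset.sum_Icc_succ_top (by omega)]
    have h1 : ∑ j ∈ Finset.Icc 1 n, digit b y j * b ^ (n + 1 - j) = b * ⌊y * (b : ℝ) ^ n⌋₊ := by
      rw [← ih, Finset.mul_sum]
      refine Finset.sum_congr rfl fun j hj => ?_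
      rw [Nat.sub_add_comm (Finset.mem_Icc.mp hj).2, pow_succ]
      ring
    have h2 : ⌊y * (b : ℝ) ^ n⌋₊ = ⌊y * (b : ℝ) ^ (n + 1)⌋₊ / b := by
      rw [← Nat.floor_div_natCast, pow_succ, ← mul_assoc, mul_div_cancel_right₀]
      positivity
    rw [h1, h2, digit, if_neg hy.ne]
    simp [Nat.div_add_mod]

/-- The number of new positions that step `k` makes available: the first `b` positions at step `1`,
and those from `b^(k-1)` to `b^k` at a step `k ≥ 2`. -/
def layer (b : ℕ) : ℕ → ℕ
  | 0 => 0
  | 1 => b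
  | k + 2 => (b - 1) * b ^ (k + 1)

theorem sum_layer {b : ℕ} (hb : 2 ≤ b) {k : ℕ} (hk : 1 ≤ k) :
    ∑ l ∈ Finset.range (k + 1), layer b l = b ^ k := by
  induction k, hk using Nat.le_induction with
  | base => simp [Finset.sum_range_succ, layer]
  | succ k hk ih =>
    obtain ⟨m, rfl⟩ := Nat.exists_eq_succ_of_ne_zero (by omega : k ≠ 0)
    obtain ⟨c, rfl⟩ := Nat.exists_eq_add_of_le' (show 1 ≤ b by omega)
    rw [Finset.sum_range_succ, ih]
    simp only [layer, Nat.add_sub_cancel, Nat.succ_eq_add_one]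
    ring

/-- The total length of the blocks of multiplicity `i` prescribed for step `k`. -/
noncomputable def stepLen (b : ℕ) (p : ℕ → ℝ) (k i : ℕ) : ℕ :=
  ∑ j ∈ Finset.Icc 1 (g k), blockCount b p k i j * b ^ (k - j)

theorem g_le (k : ℕ) : g k ≤ k := by unfold g; omega

theorem g_add_half (k : ℕ) : g k + k / 2 = k := by unfold g; omega

section Digits

variable {b : ℕ} {p : ℕ → ℝ}

theorem blockCount_le (hb : 2 ≤ b) (k i j : ℕ) : blockCount b p k i j ≤ b := by
  unfold blockCount
  split_ifs
  · exact (digit_lt hb _ _).le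
  · exact (digit_lt hb _ _).le
  · exact Nat.zero_le b

theorem stepLen_zero_left (i : ℕ) : stepLen b p 0 i = 0 := by simp [stepLen, g]

/-- The prescribed length is the truncation of the share `p i` of the layer to `g k` digits. -/
theorem exists_stepLen_eq_floor (hb : 2 ≤ b) {k i : ℕ} (hk : 1 ≤ k) (hi : 1 ≤ i)
    (hp0 : 0 ≤ p i) (hp1 : p i < 1) : ∃ y : ℝ, 0 ≤ y ∧ y * (b : ℝ) ^ k = p i * layer b k ∧
      stepLen b p k i = ⌊y * (b : ℝ) ^ g k⌋₊ * b ^ (k / 2) := by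
  have hb0 : (2 : ℝ) ≤ b := by exact_mod_cast hb
  have key : ∀ y : ℝ, y < 1 → (∀ j ∈ Finset.Icc 1 (g k), blockCount b p k i j = digit b y j) →
      stepLen b p k i = ⌊y * (b : ℝ) ^ g k⌋₊ * b ^ (k / 2) := by
    intro y hy hd
    rw [← sum_digit hb hy, stepLen, Finset.sum_mul]
    refine Finset.sum_congr rfl fun j hj => ?_
    have h1 := (Finset.mem_Icc.mp hj).2
    have h2 := g_add_half k
    rw [hd j hj, mul_assoc, ← pow_add]
    congr 2
    omega
  by_cases h1 : k = 1
  · subst h1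
    refine ⟨p i, hp0, by simp [layer], key _ hp1 fun j hj => ?_⟩
    rw [Finset.mem_Icc] at hj
    rw [blockCount, if_pos ⟨le_rfl, hi, hj⟩, if_pos rfl]
  · obtain ⟨m, rfl⟩ := Nat.exists_eq_add_of_le' (show 2 ≤ k by omega)
    have h3 : ((b : ℝ) - 1) / b ≤ 1 := by rw [div_le_one (by linarith)]; linarith
    have h4 : 0 ≤ ((b : ℝ) - 1) / b := div_nonneg (by linarith) (by linarith)
    refine ⟨((b : ℝ) - 1) / b * p i, by positivity, ?_, key _ (by nlinarith) fun j hj => ?_⟩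
    · simp only [layer]
      push_cast [Nat.cast_sub (show 1 ≤ b by omega)]
      field_simp
      ring
    · rw [Finset.mem_Icc] at hj
      rw [blockCount, if_pos ⟨hk, hi, hj⟩, if_neg h1]

theorem stepLen_le (hb : 2 ≤ b) (k : ℕ) {i : ℕ} (hi : 1 ≤ i) (hp0 : 0 ≤ p i) (hp1 : p i < 1) :
    (stepLen b p k i : ℝ) ≤ p i * layer b k := by
  obtain _ | k := k
  · simp [stepLen_zero_left, layer]
  obtain ⟨y, hy, hyk, h⟩ := exists_stepLen_eq_floor hb (Nat.le_add_left 1 k) hi hp0 hp1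
  rw [h, ← hyk]
  push_cast
  calc (⌊y * (b : ℝ) ^ g (k + 1)⌋₊ : ℝ) * b ^ ((k + 1) / 2)
      ≤ y * (b : ℝ) ^ g (k + 1) * b ^ ((k + 1) / 2) := by
        gcongr
        exact Nat.floor_le (by positivity)
    _ = y * (b : ℝ) ^ (k + 1) := by rw [mul_assoc, ← pow_add, g_add_half]

theorem le_stepLen (hb : 2 ≤ b) (k : ℕ) {i : ℕ} (hi : 1 ≤ i) (hp0 : 0 ≤ p i) (hp1 : p i < 1) :
    p i * layer b k - (b : ℝ) ^ (k / 2) ≤ stepLen b p k i := by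
  obtain _ | k := k
  · rw [stepLen_zero_left]
    simp [layer]
  obtain ⟨y, hy, hyk, h⟩ := exists_stepLen_eq_floor hb (Nat.le_add_left 1 k) hi hp0 hp1
  rw [h, ← hyk]
  push_cast
  calc y * (b : ℝ) ^ (k + 1) - (b : ℝ) ^ ((k + 1) / 2)
      = (y * (b : ℝ) ^ g (k + 1) - 1) * b ^ ((k + 1) / 2) := by
        rw [sub_mul, one_mul, mul_assoc, ← pow_add, g_add_half]
    _ ≤ (⌊y * (b : ℝ) ^ g (k + 1)⌋₊ : ℝ) * b ^ ((k + 1) / 2) := by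
        gcongr
        exact (Nat.sub_one_lt_floor _).le

/-- Only finitely many kinds of blocks are prescribed for each step. -/
theorem exists_forall_blockCount_eq_zero (hb : 2 ≤ b) (hp0 : ∀ i, 0 ≤ p i) (hp1 : ∀ i, p i < 1)
    (hp : Summable p) (k : ℕ) : ∃ I, ∀ i, I ≤ i → ∀ j, blockCount b p k i j = 0 := by
  have h1 : Tendsto (fun i => p i * layer b k) atTop (𝓝 (0 * layer b k)) :=
    hp.tendsto_atTop_zero.mul_const _
  rw [zero_mul] at h1
  obtain ⟨I, hI⟩ := eventually_atTop.mp (h1.eventually_lt_const one_pos)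
  refine ⟨I, fun i hi j => ?_⟩
  by_contra h
  have hcond : 1 ≤ k ∧ 1 ≤ i ∧ 1 ≤ j ∧ j ≤ g k := by
    by_contra hcond
    exact h (by rw [blockCount, if_neg hcond])
  have h2 : (stepLen b p k i : ℝ) < 1 :=
    (stepLen_le hb k hcond.2.1 (hp0 i) (hp1 i)).trans_lt (hI i hi)
  have h3 : stepLen b p k i = 0 := by
    have : stepLen b p k i < 1 := by exact_mod_cast h2
    omega
  rw [stepLen, Finset.sum_eq_zero_iff] at h3
  have h4 := h3 j (Finset.mem_Icc.mpr hcond.2.2)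
  have : 0 < b ^ (k - j) := pow_pos (by omega) _
  simp_all

end Digits

/-! ### Sums over the selected blocks -/

/-- A list of blocks contains the prescribed number of blocks of each kind for step `k`. -/
def HasCounts (b : ℕ) (p : ℕ → ℝ) (k : ℕ) (L : List Block) : Prop :=
  ∀ i j : ℕ, L.countP (fun B => decide (B.mult = i ∧ B.scale = j)) = blockCount b p k i j

theorem sum_map_eq_sum_countP (L : List Block) (J : Finset (ℕ × ℕ))
    (hJ : ∀ B ∈ L, (B.mult, B.scale) ∈ J) (F : ℕ → ℕ → ℕ) :
    (L.map fun B => F B.mult B.scale).sum =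
      ∑ q ∈ J, L.countP (fun B => decide (B.mult = q.1 ∧ B.scale = q.2)) * F q.1 q.2 := by
  induction L with
  | nil => simp
  | cons B L ih =>
    simp only [List.map_cons, List.sum_cons, List.countP_cons, add_mul, Finset.sum_add_distrib]
    rw [ih fun C hC => hJ C (List.mem_cons_of_mem _ hC), add_comm]
    congr 1
    rw [Finset.sum_eq_single (B.mult, B.scale)]
    · simp
    · rintro ⟨i, j⟩ - hne
      have : ¬ (B.mult = i ∧ B.scale = j) := fun h => hne (by rw [h.1, h.2])
      simp [this]
    · exact fun h => absurd (hJ B List.mem_cons_self) h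

section Counts

variable {b k : ℕ} {p : ℕ → ℝ} {L : List Block}

theorem HasCounts.bounds (h : HasCounts b p k L) {B : Block} (hB : B ∈ L) :
    1 ≤ k ∧ 1 ≤ B.mult ∧ 1 ≤ B.scale ∧ B.scale ≤ g k := by
  have h1 := h B.mult B.scale
  by_contra hcond
  rw [blockCount, if_neg hcond, List.countP_eq_zero] at h1
  simpa using h1 B hB

theorem HasCounts.sum_map (h : HasCounts b p k L) {I : ℕ} (hI : ∀ B ∈ L, B.mult < I)
    (F : ℕ → ℕ → ℕ) : (L.map fun B => F B.mult B.scale).sum =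
      ∑ i ∈ Finset.Ico 1 I, ∑ j ∈ Finset.Icc 1 (g k), blockCount b p k i j * F i j := by
  rw [sum_map_eq_sum_countP L (Finset.Ico 1 I ×ˢ Finset.Icc 1 (g k)), Finset.sum_product]
  · simp only [h _ _]
  · intro B hB
    have := h.bounds hB
    simp [this, hI B hB]

theorem exists_forall_mult_lt (L : List Block) : ∃ I, ∀ B ∈ L, B.mult < I :=
  ⟨(L.map Block.mult).sum + 1, fun _ hB =>
    Nat.lt_succ_of_le (List.le_sum_of_mem (List.mem_map_of_mem hB))⟩

/-- The blocks of multiplicity `i` alone. -/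
theorem HasCounts.sum_map_ite (h : HasCounts b p k L) {i : ℕ} (hi : 1 ≤ i) (F : ℕ → ℕ) :
    (L.map fun B => if B.mult = i then F B.scale else 0).sum =
      ∑ j ∈ Finset.Icc 1 (g k), blockCount b p k i j * F j := by
  obtain ⟨I, hI⟩ := exists_forall_mult_lt L
  rw [h.sum_map (I := max I (i + 1)) (fun B hB => (hI B hB).trans_le (le_max_left _ _))
    fun i' j => if i' = i then F j else 0, Finset.sum_eq_single i]
  · simp
  · intro i' _ hne
    simp [hne]
  · intro hni
    exact absurd (Finset.mem_Ico.mpr ⟨hi, lt_max_of_lt_right (Nat.lt_succ_self i)⟩) hni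

theorem HasCounts.sum_len (h : HasCounts b p k L) {I : ℕ} (hI : ∀ B ∈ L, B.mult < I) :
    (L.map fun B => B.len b k).sum = ∑ i ∈ Finset.Ico 1 I, stepLen b p k i := by
  have := h.sum_map hI fun _ j => b ^ (k - j)
  simpa [Block.len, stepLen] using this

theorem HasCounts.sum_len_le (hb : 2 ≤ b) (hp0 : ∀ i, 0 ≤ p i) (hp1 : ∀ i, p i < 1)
    (hsum : HasSum p 1) (h : HasCounts b p k L) :
    (((L.map fun B => B.len b k).sum : ℕ) : ℝ) ≤ (1 - p 0) * layer b k := by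
  obtain ⟨I, hI⟩ := exists_forall_mult_lt L
  rw [h.sum_len hI]
  push_cast
  have h0 : ∑ i ∈ Finset.range (max 1 I), p i ≤ 1 := sum_le_hasSum _ (fun i _ => hp0 i) hsum
  rw [Finset.range_eq_Ico, Finset.sum_eq_sum_Ico_succ_bot (by simp)] at h0
  calc ∑ i ∈ Finset.Ico 1 I, (stepLen b p k i : ℝ)
      ≤ ∑ i ∈ Finset.Ico 1 I, p i * layer b k := Finset.sum_le_sum fun i hi =>
        stepLen_le hb k (Finset.mem_Ico.mp hi).1 (hp0 i) (hp1 i)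
    _ ≤ ∑ i ∈ Finset.Ico (0 + 1) (max 1 I), p i * layer b k :=
        Finset.sum_le_sum_of_subset_of_nonneg (Finset.Ico_subset_Ico le_rfl (le_max_right _ _))
          fun i _ _ => mul_nonneg (hp0 i) (Nat.cast_nonneg _)
    _ ≤ (1 - p 0) * layer b k := by
        rw [← Finset.sum_mul]
        gcongr
        linarith

end Counts

/-! ### The selection can always be continued -/

/-- Blocks of the given kinds, placed one after another from position `a` on. -/
def place (b k : ℕ) : ℕ → List (ℕ × ℕ) → List Block
  | _, [] => []
  | a, q :: t => ⟨q.1, q.2, a⟩ :: place b k (a + b ^ (k - q.2)) t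

section Place

variable {b k : ℕ}

theorem countP_place (a : ℕ) (τ : List (ℕ × ℕ)) (i j : ℕ) :
    (place b k a τ).countP (fun B => decide (B.mult = i ∧ B.scale = j)) = τ.count (i, j) := by
  induction τ generalizing a with
  | nil => simp [place]
  | cons q t ih =>
    rw [place, List.countP_cons, List.count_cons, ih]
    simp [Prod.ext_iff]

theorem le_start_of_mem_place {a : ℕ} {τ : List (ℕ × ℕ)} {B : Block} (hB : B ∈ place b k a τ) :
    a ≤ B.start := by
  induction τ generalizing a with
  | nil => simp [place] at hB
  | cons q t ih =>
    rcases List.mem_cons.mp hB with rfl | h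
    · exact le_rfl
    · exact (Nat.le_add_right _ _).trans (ih h)

theorem end_le_of_mem_place {a : ℕ} {τ : List (ℕ × ℕ)} {B : Block} (hB : B ∈ place b k a τ) :
    B.start + B.len b k ≤ a + ((place b k a τ).map fun B => B.len b k).sum := by
  induction τ generalizing a with
  | nil => simp [place] at hB
  | cons q t ih =>
    simp only [place, List.map_cons, List.sum_cons]
    rcases List.mem_cons.mp hB with rfl | h
    · simp
    · refine (ih h).trans (le_of_eq ?_)
      simp [Block.len, add_assoc]

theorem pairwise_disjoint_place (a : ℕ) (τ : List (ℕ × ℕ)) :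
    (place b k a τ).Pairwise fun B C => Disjoint (B.positions b k) (C.positions b k) := by
  induction τ generalizing a with
  | nil => simp [place]
  | cons q t ih =>
    refine List.pairwise_cons.mpr ⟨fun C hC => ?_, ih _⟩
    exact Finset.Ico_disjoint_Ico_consecutive a _ _ |>.mono_right
      (Finset.Ico_subset_Ico (le_start_of_mem_place hC) le_rfl)

theorem covered_of_lt_start_place {a : ℕ} {τ : List (ℕ × ℕ)} {B : Block}
    (hB : B ∈ place b k a τ) {m : ℕ} (ham : a ≤ m) (hm : m < B.start) :
    ∃ C ∈ place b k a τ, m ∈ C.positions b k := by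
  induction τ generalizing a with
  | nil => simp [place] at hB
  | cons q t ih =>
    rcases List.mem_cons.mp hB with rfl | h
    · exact absurd hm (not_lt.mpr ham)
    · by_cases h1 : m < a + b ^ (k - q.2)
      · exact ⟨_, List.mem_cons_self, Finset.mem_Ico.mpr ⟨ham, h1⟩⟩
      · obtain ⟨C, hC, hmC⟩ := ih h (not_lt.mp h1)
        exact ⟨C, List.mem_cons_of_mem _ hC, hmC⟩

end Place

theorem ValidStep.congr {b k : ℕ} {p : ℕ → ℝ} {S T : ℕ → List Block} (h : ValidStep b p S k)
    (hST : ∀ l ≤ k, T l = S l) : ValidStep b p T k where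
  count := by rw [hST k le_rfl]; exact h.count
  inside := by rw [hST k le_rfl]; exact h.inside
  disjoint_self := by rw [hST k le_rfl]; exact h.disjoint_self
  disjoint_earlier l hl := by rw [hST k le_rfl, hST l hl.le]; exact h.disjoint_earlier l hl
  no_gaps hk := by
    rw [hST k le_rfl]
    intro B hB m hm
    obtain ⟨l, hl, C, hC, hmC⟩ := h.no_gaps hk B hB m hm
    exact ⟨l, hl, C, by rwa [hST l hl], hmC⟩

section Continue

variable {b : ℕ} {p : ℕ → ℝ} {S : ℕ → List Block}

theorem ValidStep.hasCounts {k : ℕ} (h : ValidStep b p S k) : HasCounts b p k (S k) := h.count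

/-- For `b = 2` the positions covered up to some step form an initial segment. -/
theorem covered_of_lt {n : ℕ} (hb2 : b = 2) (hS : ∀ k < n, ValidStep b p S k) {m m' : ℕ}
    (hm : ∃ l < n, ∃ C ∈ S l, m ∈ C.positions b l) (hlt : m' < m) :
    ∃ l < n, ∃ C ∈ S l, m' ∈ C.positions b l := by
  obtain ⟨l, hl, C, hC, hmC⟩ := hm
  have h1 := Finset.mem_Ico.mp hmC
  by_cases h : C.start ≤ m'
  · exact ⟨l, hl, C, hC, Finset.mem_Ico.mpr ⟨h, by omega⟩⟩
  · obtain ⟨l', hl', D⟩ := (hS l hl).no_gaps (Or.inr hb2) C hC m' (not_le.mp h)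
    exact ⟨l', by omega, D⟩

/-- A position from which there is room for the next step, after all the earlier blocks. -/
theorem exists_next_position (hb : 2 ≤ b) {n : ℕ} (hn : 1 ≤ n)
    (hS : ∀ k < n, ValidStep b p S k) :
    ∃ a, (∀ l < n, ∀ C ∈ S l, ∀ m ∈ C.positions b l, m < a) ∧ a + layer b n ≤ b ^ n ∧
      (n = 1 ∨ b = 2 → ∀ m < a, ∃ l < n, ∃ C ∈ S l, m ∈ C.positions b l) := by
  have hin : ∀ l < n, ∀ C ∈ S l, ∀ m ∈ C.positions b l, 2 ≤ n ∧ m < b ^ (n - 1) := by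
    intro l hl C hC m hm
    have h1 := (hS l hl).inside C hC
    have h2 := Finset.mem_Ico.mp hm
    have h3 : b ^ l ≤ b ^ (n - 1) := Nat.pow_le_pow_right (by omega) (by omega)
    have h4 := ((hS l hl).hasCounts.bounds hC).1
    omega
  rcases hn.eq_or_lt with rfl | h2
  · refine ⟨0, fun l hl C hC m hm => ?_, by simp [layer], by simp⟩
    have := (hin l hl C hC m hm).1
    omega
  have hroom : b ^ (n - 1) + layer b n = b ^ n := by
    obtain ⟨m, rfl⟩ := Nat.exists_eq_add_of_le' h2
    obtain ⟨c, rfl⟩ := Nat.exists_eq_add_of_le' (show 1 ≤ b by omega)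
    simp only [layer, Nat.add_sub_cancel, Nat.succ_eq_add_one,
      show m + (1 + 1) - 1 = m + 1 by omega]
    ring
  by_cases hb2 : b = 2
  · classical
    have hex : ∃ a, ¬ ∃ l < n, ∃ C ∈ S l, a ∈ C.positions b l :=
      ⟨b ^ (n - 1), fun ⟨l, hl, C, hC, h⟩ => lt_irrefl _ (hin l hl C hC _ h).2⟩
    refine ⟨Nat.find hex, fun l hl C hC m hm => ?_, ?_, fun _ m hm => ?_⟩
    · rcases lt_trichotomy m (Nat.find hex) with h | h | h
      · exact h
      · exact absurd ⟨l, hl, C, hC, h ▸ hm⟩ (Nat.find_spec hex)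
      · exact absurd (covered_of_lt hb2 hS ⟨l, hl, C, hC, hm⟩ h) (Nat.find_spec hex)
    · rw [← hroom]
      gcongr
      exact Nat.find_min' hex
        fun ⟨l, hl, C, hC, h⟩ => lt_irrefl _ (hin l hl C hC _ h).2
    · exact not_not.mp (Nat.find_min hex hm)
  · exact ⟨b ^ (n - 1), fun l hl C hC m hm => (hin l hl C hC m hm).2, hroom.le,
      fun h => by omega⟩

theorem exists_validStep (hb : 2 ≤ b) (hp0 : ∀ i, 0 ≤ p i) (hp1 : ∀ i, p i < 1)
    (hsum : HasSum p 1) {n : ℕ} (hS : ∀ k < n, ValidStep b p S k) :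
    ∃ T : ℕ → List Block, (∀ k < n, T k = S k) ∧ ValidStep b p T n := by
  rcases Nat.eq_zero_or_pos n with rfl | hn
  · refine ⟨fun _ => [], by simp, ⟨fun i j => by simp [blockCount], ?_, ?_, ?_, ?_⟩⟩ <;> simp
  obtain ⟨a, ha, hroom, hcov⟩ := exists_next_position hb hn hS
  obtain ⟨I, hI⟩ := exists_forall_blockCount_eq_zero hb hp0 hp1 hsum.summable n
  let c : ℕ × ℕ →₀ ℕ := Finsupp.onFinset (Finset.range I ×ˢ Finset.range (g n + 1))
    (fun q => blockCount b p n q.1 q.2) fun q hq => by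
      rw [Finset.mem_product, Finset.mem_range, Finset.mem_range]
      constructor
      · by_contra h
        exact hq (hI _ (not_lt.mp h) _)
      · by_contra h
        exact hq (by rw [blockCount, if_neg]; omega)
  set L := place b n a (Finsupp.toMultiset c).toList with hL
  have hcount : HasCounts b p n L := by
    intro i j
    have h1 : (Finsupp.toMultiset c).toList.count (i, j) = (Finsupp.toMultiset c).count (i, j) := by
      conv_rhs => rw [← Multiset.coe_toList (Finsupp.toMultiset c), Multiset.coe_count]
      simp only [List.count_eq_countP]
      exact List.countP_congr (by simp)
    rw [hL, countP_place, h1, Finsupp.count_toMultiset]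
    rfl
  have hlen : (L.map fun B => B.len b n).sum ≤ layer b n := by
    have h1 := hcount.sum_len_le hb hp0 hp1 hsum
    have h2 : (1 - p 0) * (layer b n : ℝ) ≤ 1 * layer b n := by
      gcongr
      linarith [hp0 0]
    rw [one_mul] at h2
    exact_mod_cast h1.trans h2
  have hT : ∀ k < n, Function.update S n L k = S k := fun k hk =>
    Function.update_of_ne hk.ne _ _
  have hTn : Function.update S n L n = L := Function.update_self _ _ _
  refine ⟨Function.update S n L, hT, ?_, ?_, ?_, ?_, ?_⟩
  · rw [hTn]
    exact hcount
  · rw [hTn]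
    intro B hB
    have h1 := end_le_of_mem_place hB
    rw [← hL] at h1
    omega
  · rw [hTn]
    exact pairwise_disjoint_place _ _
  · rw [hTn]
    intro l hl B hB C hC
    rw [hT l hl] at hB
    rw [Finset.disjoint_left]
    intro m hm hm'
    have h1 := ha l hl B hB m hm
    have h2 := le_start_of_mem_place hC
    have h3 := (Finset.mem_Ico.mp hm').1
    omega
  · rw [hTn]
    intro h B hB m hm
    by_cases hma : m < a
    · obtain ⟨l, hl, C, hC, hmC⟩ := hcov h m hma
      exact ⟨l, hl.le, C, by rwa [hT l hl], hmC⟩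
    · obtain ⟨C, hC, hmC⟩ := covered_of_lt_start_place hB (not_lt.mp hma) hm
      exact ⟨n, le_rfl, C, by rwa [hTn], hmC⟩

theorem exists_continuation (hb : 2 ≤ b) (hp0 : ∀ i, 0 ≤ p i) (hp1 : ∀ i, p i < 1)
    (hsum : HasSum p 1) (n : ℕ) (S : ℕ → List Block) (hS : ∀ k < n, ValidStep b p S k) :
    ∃ T : ℕ → List Block, (∀ k < n, T k = S k) ∧ ∀ k, ValidStep b p T k := by
  have hstep : ∀ (m : ℕ) (U : ℕ → List Block), (∀ k < m, ValidStep b p U k) →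
      ∃ T : ℕ → List Block, (∀ k < m, T k = U k) ∧ ∀ k < m + 1, ValidStep b p T k := by
    intro m U hU
    obtain ⟨T, hT, hTm⟩ := exists_validStep hb hp0 hp1 hsum hU
    refine ⟨T, hT, fun k hk => ?_⟩
    rcases Nat.lt_succ_iff_lt_or_eq.mp hk with h | rfl
    · exact (hU k h).congr fun l hl => hT l (by omega)
    · exact hTm
  choose! F hF hFvalid using hstep
  let U : ℕ → ℕ → List Block := fun m => Nat.rec S (fun m V => F (n + m) V) m
  have hU : ∀ m, ∀ k < n + m, ValidStep b p (U m) k := by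
    intro m
    induction m with
    | zero => exact hS
    | succ m ih => exact hFvalid (n + m) (U m) ih
  have hagree : ∀ m r, ∀ k < n + m, U (m + r) k = U m k := by
    intro m r
    induction r with
    | zero => exact fun _ _ => rfl
    | succ r ih =>
      intro k hk
      rw [← ih k hk]
      exact hF (n + (m + r)) (U (m + r)) (hU (m + r)) k (by omega)
  refine ⟨fun k => U (k + 1) k, fun k hk => ?_, fun k => ?_⟩
  · have := hagree 0 (k + 1) k hk
    rwa [Nat.zero_add] at this
  · refine (hU (k + 1) k (by omega)).congr fun l hl => ?_
    obtain ⟨r, hr⟩ := Nat.exists_eq_add_of_le (Nat.add_le_add_right hl 1)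
    rw [hr]
    exact (hagree (l + 1) r l (by omega)).symm

end Continue

/-! ### Counting occurrences -/

section Occurrences

variable {Ω : Type*} [DecidableEq Ω]

theorem occ_add_le_append (u v : List Ω) {w : List Ω} (hw : w ≠ []) :
    occ u w + occ v w ≤ occ (u ++ v) w := by
  have hpos : 0 < w.length := List.length_pos_iff.mpr hw
  unfold occ
  rw [add_comm, ← Finset.card_map (addLeftEmbedding u.length), ← Finset.card_union_of_disjoint]
  · refine Finset.card_le_card fun m hm => ?_
    simp only [Finset.mem_union, Finset.mem_map, Finset.mem_filter, Finset.mem_range,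
      addLeftEmbedding_apply, List.length_append] at hm ⊢
    rcases hm with ⟨n, ⟨h1, h2⟩, rfl⟩ | ⟨h1, h2⟩
    · refine ⟨by omega, ?_⟩
      rw [List.drop_append, List.drop_eq_nil_of_le (by omega)]
      simpa using h2
    · refine ⟨by omega, ?_⟩
      rw [List.drop_append_of_le_length (by omega), List.take_append_of_le_length (by simp; omega)]
      exact h2
  · rw [Finset.disjoint_left]
    intro m hm hm'
    simp only [Finset.mem_map, Finset.mem_filter, Finset.mem_range,
      addLeftEmbedding_apply] at hm hm'
    obtain ⟨n, -, rfl⟩ := hm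
    omega

theorem mul_occ_le_replicate (n : ℕ) (u : List Ω) {w : List Ω} (hw : w ≠ []) :
    n * occ u w ≤ occ (List.replicate n u).flatten w := by
  induction n with
  | zero => simp
  | succ n ih =>
    rw [List.replicate_succ, List.flatten_cons]
    have := occ_add_le_append u (List.replicate n u).flatten hw
    linarith

theorem occ_pref (x : ℕ → Ω) (M : ℕ) {k : ℕ} (w : Fin k → Ω) :
    occ (pref x M) (List.ofFn w) =
      ((Finset.range (M + 1 - k)).filter fun m => window x k m = w).card := by
  unfold occ
  have hlen : (pref x M).length = M := by simp [pref]
  rw [List.length_ofFn, hlen]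
  congr 1
  refine Finset.filter_congr fun m hm => ?_
  have hm := Finset.mem_range.mp hm
  have h1 : ((pref x M).drop m).take k = List.ofFn (window x k m) := by
    apply List.ext_getElem
    · simp [hlen]
      omega
    · intro j _ _
      simp [pref, window]
  rw [h1, List.ofFn_inj]

theorem occ_segment (x : ℕ → Ω) (s M : ℕ) {k : ℕ} (w : Fin k → Ω) :
    occ (segment x s M) (List.ofFn w) =
      ((Finset.Ico s (s + (M + 1 - k))).filter fun m => window x k m = w).card := by
  have h1 : segment x s M = pref (fun m => x (s + m)) M := rfl
  rw [h1, occ_pref, ← Finset.card_map (addLeftEmbedding s)]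
  congr 1
  ext m
  simp only [Finset.mem_map, Finset.mem_filter, Finset.mem_range, addLeftEmbedding_apply,
    Finset.mem_Ico]
  have h2 : ∀ n, window (fun m => x (s + m)) k n = window x k (s + n) := fun n => by
    funext j
    simp [window, add_assoc]
  constructor
  · rintro ⟨n, ⟨h3, h4⟩, rfl⟩
    exact ⟨by omega, by rw [← h2, h4]⟩
  · rintro ⟨h3, h4⟩
    exact ⟨m - s, ⟨by omega, by rw [h2, Nat.add_sub_cancel' h3.1, h4]⟩, by omega⟩

theorem sum_occ_pref [Fintype Ω] (x : ℕ → Ω) (M k : ℕ) :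
    ∑ w : Fin k → Ω, occ (pref x M) (List.ofFn w) = M + 1 - k := by
  simp only [occ_pref]
  rw [← Finset.card_eq_sum_card_fiberwise (fun _ _ => Finset.mem_univ _), Finset.card_range]

end Occurrences

/-! ### Labelled positions -/

section Label

variable {α : Type*} {R : α → Finset ℕ} {m : α → ℕ}

/-- The sum of the weights `m a` of those `a` in the list whose set `R a` contains `s`. -/
def label (R : α → Finset ℕ) (m : α → ℕ) (L : List α) (s : ℕ) : ℕ :=
  (L.map fun a => if s ∈ R a then m a else 0).sum

theorem exists_mem_of_label_ne_zero {L : List α} {s : ℕ} (h : label R m L s ≠ 0) :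
    ∃ a ∈ L, s ∈ R a := by
  by_contra! hc
  exact h (List.sum_eq_zero fun n hn => by
    obtain ⟨a, ha, rfl⟩ := List.mem_map.mp hn
    rw [if_neg (hc a ha)])

theorem card_label_eq {L : List α} (hL : L.Pairwise fun a a' => Disjoint (R a) (R a')) {N : ℕ}
    (hN : ∀ a ∈ L, R a ⊆ Finset.range N) {i : ℕ} (hi : 1 ≤ i) :
    ((Finset.range N).filter fun s => label R m L s = i).card =
      (L.map fun a => if m a = i then (R a).card else 0).sum := by
  induction L with
  | nil =>
    simp only [label, List.map_nil, List.sum_nil, Finset.card_eq_zero, Finset.filter_eq_empty_iff]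
    omega
  | cons a L ih =>
    rw [List.pairwise_cons] at hL
    have h0 : ∀ s ∈ R a, label R m L s = 0 := by
      intro s hs
      by_contra h
      obtain ⟨a', ha', hs'⟩ := exists_mem_of_label_ne_zero h
      exact Finset.disjoint_left.mp (hL.1 a' ha') hs hs'
    have hcons : ∀ s, label R m (a :: L) s = if s ∈ R a then m a else label R m L s := by
      intro s
      have : label R m (a :: L) s = (if s ∈ R a then m a else 0) + label R m L s := by
        simp [label]
      rw [this]
      split_ifs with hs
      · rw [h0 s hs, add_zero]
      · rw [zero_add]
    rw [List.map_cons, List.sum_cons,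
      ← ih hL.2 fun a' ha' => hN a' (List.mem_cons_of_mem _ ha')]
    have hset : (Finset.range N).filter (fun s => label R m (a :: L) s = i) =
        (if m a = i then R a else ∅) ∪ (Finset.range N).filter fun s => label R m L s = i := by
      ext s
      have hsN : s ∈ R a → s ∈ Finset.range N := fun hs => hN a List.mem_cons_self hs
      have := h0 s
      simp only [Finset.mem_filter, Finset.mem_union, hcons]
      by_cases hs : s ∈ R a
      · simp only [hs, hsN hs, if_true, true_and, this hs]
        split_ifs with hm
        · simp [hm, hs]
        · simp [hm]
          omega
      · split_ifs <;> simp [hs]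
    rw [hset, Finset.card_union_of_disjoint]
    · split_ifs <;> simp
    · rw [Finset.disjoint_left]
      intro s hs hs'
      split_ifs at hs with hm
      · have h1 := h0 s hs
        have h2 := (Finset.mem_filter.mp hs').2
        omega
      · simp at hs

theorem card_le_sum_of_covered {L : List α} {F : Finset ℕ} (hF : ∀ s ∈ F, ∃ a ∈ L, s ∈ R a) :
    F.card ≤ (L.map fun a => (R a).card).sum := by
  induction L generalizing F with
  | nil =>
    have : F = ∅ := Finset.eq_empty_of_forall_notMem fun s hs => by simpa using hF s hs
    simp [this]
  | cons a L ih =>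
    rw [List.map_cons, List.sum_cons]
    have h1 := ih (F := F \ R a) fun s hs => by
      rw [Finset.mem_sdiff] at hs
      obtain ⟨a', ha', hs'⟩ := hF s hs.1
      rcases List.mem_cons.mp ha' with rfl | h
      · exact absurd hs' hs.2
      · exact ⟨a', h, hs'⟩
    have h2 := Finset.card_le_card_sdiff_add_card (s := F) (t := R a)
    omega

/-- If `φ` is injective on the positions with nonzero label, then the fibre sums of the label
take each value `i ≥ 1` as often as the label itself. -/
theorem card_fiber_sum_eq {W : Type*} [Fintype W] [DecidableEq W] (φ : ℕ → W) (c : ℕ → ℕ) (N : ℕ)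
    (hinj : ∀ s t, c s ≠ 0 → c t ≠ 0 → φ s = φ t → s = t) {i : ℕ} (hi : 1 ≤ i) :
    (Finset.univ.filter fun w => (∑ s ∈ Finset.range N, if φ s = w then c s else 0) = i).card =
      ((Finset.range N).filter fun s => c s = i).card := by
  have hval : ∀ s ∈ Finset.range N, c s ≠ 0 →
      (∑ t ∈ Finset.range N, if φ t = φ s then c t else 0) = c s := by
    intro s hs hcs
    rw [Finset.sum_eq_single s]
    · simp
    · intro t _ hts
      by_cases hct : c t = 0
      · simp [hct]
      · exact if_neg fun h => hts (hinj t s hct hcs h)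
    · exact fun h => absurd hs h
  symm
  refine Finset.card_bij (fun s _ => φ s) (fun s hs => ?_) (fun s hs t ht h => ?_) fun w hw => ?_
  · rw [Finset.mem_filter] at hs ⊢
    exact ⟨Finset.mem_univ _, by rw [hval s hs.1 (by omega), hs.2]⟩
  · rw [Finset.mem_filter] at hs ht
    exact hinj s t (by omega) (by omega) h
  · rw [Finset.mem_filter] at hw
    obtain ⟨s, hs, hne⟩ := Finset.exists_ne_zero_of_sum_ne_zero
      (show (∑ s ∈ Finset.range N, if φ s = w then c s else 0) ≠ 0 by omega)
    obtain ⟨rfl, hcs⟩ : φ s = w ∧ c s ≠ 0 := by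
      by_cases h : φ s = w
      · exact ⟨h, by simpa [h] using hne⟩
      · simp [h] at hne
    exact ⟨s, Finset.mem_filter.mpr ⟨hs, by rw [← hval s hs hcs, hw.2]⟩, rfl⟩

end Label

/-! ### All blocks selected up to a step -/

/-- The blocks selected at the steps `1, …, k`, in order, each with the number of its step. -/
def selected (S : ℕ → List Block) : ℕ → List (ℕ × Block)
  | 0 => []
  | k + 1 => selected S k ++ (S (k + 1)).map (Prod.mk (k + 1))

section Selected

variable {S : ℕ → List Block}

theorem mem_selected {k : ℕ} {q : ℕ × Block} :
    q ∈ selected S k ↔ (1 ≤ q.1 ∧ q.1 ≤ k) ∧ q.2 ∈ S q.1 := by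
  induction k with
  | zero =>
    simp only [selected, List.not_mem_nil, false_iff]
    omega
  | succ k ih =>
    simp only [selected, List.mem_append, ih, List.mem_map]
    constructor
    · rintro (⟨h1, h2⟩ | ⟨B, hB, rfl⟩)
      · exact ⟨⟨h1.1, by omega⟩, h2⟩
      · exact ⟨⟨by simp, le_rfl⟩, hB⟩
    · rintro ⟨h1, h2⟩
      rcases Nat.lt_or_eq_of_le h1.2 with h | h
      · exact Or.inl ⟨⟨h1.1, by omega⟩, h2⟩
      · exact Or.inr ⟨q.2, by rwa [← h], by rw [← h]⟩

theorem sum_selected (hS : S 0 = []) (F : ℕ → Block → ℕ) (k : ℕ) :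
    ((selected S k).map fun q => F q.1 q.2).sum =
      ∑ l ∈ Finset.range (k + 1), ((S l).map (F l)).sum := by
  induction k with
  | zero => simp [selected, hS]
  | succ k ih =>
    rw [Finset.sum_range_succ, ← ih, selected, List.map_append, List.sum_append, List.map_map]
    rfl

theorem output_eq_flatMap {Ω : Type*} [Fintype Ω] (A : ℕ → Ω) (k : ℕ) :
    output A S k = (selected S k).flatMap fun q => run A q.1 q.2 := by
  induction k with
  | zero => simp [output, selected]
  | succ k ih => simp [output, selected, ih, List.flatMap_map]

variable {b : ℕ} {p : ℕ → ℝ}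

theorem pairwise_disjoint_selected (hS : ∀ k, ValidStep b p S k) (k : ℕ) :
    (selected S k).Pairwise fun q r => Disjoint (q.2.positions b q.1) (r.2.positions b r.1) := by
  induction k with
  | zero => simp [selected]
  | succ k ih =>
    rw [selected, List.pairwise_append]
    refine ⟨ih, ?_, fun q hq r hr => ?_⟩
    · rw [List.pairwise_map]
      exact (hS (k + 1)).disjoint_self
    · obtain ⟨B, hB, rfl⟩ := List.mem_map.mp hr
      have h := mem_selected.mp hq
      exact (hS (k + 1)).disjoint_earlier q.1 (by omega) _ h.2 B hB

theorem ValidStep.eq_nil (h : ValidStep b p S 0) : S 0 = [] :=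
  List.eq_nil_iff_forall_not_mem.mpr fun B hB => by
    have := (h.hasCounts.bounds hB).1
    omega

theorem end_le_of_mem_selected (hb : 2 ≤ b) (hS : ∀ k, ValidStep b p S k) {k : ℕ} {q : ℕ × Block}
    (hq : q ∈ selected S k) : q.2.start + q.2.len b q.1 ≤ b ^ k := by
  have h := mem_selected.mp hq
  exact ((hS q.1).inside q.2 h.2).trans (Nat.pow_le_pow_right (by omega) h.1.2)

theorem sum_len_selected_le (hb : 2 ≤ b) (hp0 : ∀ i, 0 ≤ p i) (hp1 : ∀ i, p i < 1)
    (hsum : HasSum p 1) (hS : ∀ k, ValidStep b p S k) {k : ℕ} (hk : 1 ≤ k) :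
    ((((selected S k).map fun q => q.2.len b q.1).sum : ℕ) : ℝ) ≤ (1 - p 0) * (b : ℝ) ^ k := by
  rw [sum_selected (hS 0).eq_nil (fun l B => B.len b l)]
  have h1 : ((b ^ k : ℕ) : ℝ) = (b : ℝ) ^ k := by push_cast; rfl
  rw [← h1, ← sum_layer hb hk]
  rw [Nat.cast_sum, Nat.cast_sum, Finset.mul_sum]
  exact Finset.sum_le_sum fun l _ => (hS l).hasCounts.sum_len_le hb hp0 hp1 hsum

/-- For `b = 2` and `p 0 ≥ 1 / 2` the blocks selected up to step `k`, which leave no gaps, lie in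
the first `2^(k-1)` positions. -/
theorem end_le_half_of_mem_selected (hb2 : b = 2) (hp0 : ∀ i, 0 ≤ p i) (hp1 : ∀ i, p i < 1)
    (hsum : HasSum p 1) (hhalf : 1 / 2 ≤ p 0) (hS : ∀ k, ValidStep b p S k) {k : ℕ} {q : ℕ × Block}
    (hq : q ∈ selected S k) : q.2.start + q.2.len b q.1 ≤ b ^ (k - 1) := by
  have hmem := mem_selected.mp hq
  have hlen : 0 < q.2.len b q.1 := pow_pos (by omega) _
  have h1 : (Finset.range (q.2.start + q.2.len b q.1)).card ≤
      ((selected S k).map fun q => (q.2.positions b q.1).card).sum := by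
    refine card_le_sum_of_covered (R := fun q : ℕ × Block => q.2.positions b q.1) fun s hs => ?_
    have hs := Finset.mem_range.mp hs
    have hlast : ∃ l < k + 1, ∃ C ∈ S l,
        q.2.start + q.2.len b q.1 - 1 ∈ C.positions b l :=
      ⟨q.1, by omega, q.2, hmem.2, Finset.mem_Ico.mpr ⟨by omega, by omega⟩⟩
    obtain ⟨l, hl, C, hC, hsC⟩ : ∃ l < k + 1, ∃ C ∈ S l, s ∈ C.positions b l := by
      rcases Nat.lt_or_eq_of_le (Nat.le_sub_one_of_lt hs) with h | h
      · exact covered_of_lt hb2 (fun l _ => hS l) hlast h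
      · exact h ▸ hlast
    exact ⟨(l, C), mem_selected.mpr ⟨⟨((hS l).hasCounts.bounds hC).1, by omega⟩, hC⟩, hsC⟩
  simp only [Block.positions, Finset.card_range, Nat.card_Ico, Nat.add_sub_cancel_left] at h1
  have h2 := sum_len_selected_le (by omega) hp0 hp1 hsum hS (by omega : 1 ≤ k)
  obtain ⟨n, rfl⟩ := Nat.exists_eq_add_of_le' (show 1 ≤ k by omega)
  refine h1.trans ?_
  have h3 : (1 - p 0) * (b : ℝ) ^ (n + 1) ≤ ((b ^ n : ℕ) : ℝ) := by
    subst hb2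
    push_cast
    rw [pow_succ]
    nlinarith [pow_pos (two_pos : (0 : ℝ) < 2) n]
  rw [Nat.add_sub_cancel]
  exact_mod_cast h2.trans h3

/-- The positions at which a word of length `k` lies inside the block. -/
def room (b k : ℕ) (q : ℕ × Block) : Finset ℕ :=
  Finset.Ico q.2.start (q.2.start + (q.2.len b q.1 + 1 - k))

theorem card_room (k : ℕ) (q : ℕ × Block) : (room b k q).card = q.2.len b q.1 + 1 - k := by
  simp [room]

theorem room_subset {k : ℕ} (hk : 1 ≤ k) (q : ℕ × Block) :
    room b k q ⊆ q.2.positions b q.1 :=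
  Finset.Ico_subset_Ico le_rfl (by omega)

theorem add_le_of_mem_room {k s : ℕ} {q : ℕ × Block} (h : s ∈ room b k q) :
    s + k ≤ q.2.start + q.2.len b q.1 := by
  have := Finset.mem_Ico.mp h
  omega

variable {Ω : Type*} [Fintype Ω] [DecidableEq Ω]

/-- The occurrences of `w` in the output that lie inside a single copy of a block are at least
the multiplicities of the blocks in which the source has the word. -/
theorem sum_label_le_occ (A : ℕ → Ω) {k : ℕ} (hk : 1 ≤ k) (w : Fin k → Ω) (N : ℕ)
    (L : List (ℕ × Block)) :
    (∑ s ∈ Finset.range N, if window A k s = w then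
      label (room (Fintype.card Ω) k) (fun q => q.2.mult) L s else 0) ≤
      occ (L.flatMap fun q => run A q.1 q.2) (List.ofFn w) := by
  have hw : List.ofFn w ≠ [] := by
    rw [← List.length_pos_iff, List.length_ofFn]
    exact hk
  induction L with
  | nil => simp [label]
  | cons q L ih =>
    rw [List.flatMap_cons]
    have h1 : (∑ s ∈ Finset.range N, if window A k s = w then
        (if s ∈ room (Fintype.card Ω) k q then q.2.mult else 0) else 0) ≤
        occ (run A q.1 q.2) (List.ofFn w) := by
      refine le_trans ?_ (mul_occ_le_replicate _ _ hw)
      rw [occ_segment]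
      simp only [← ite_and]
      rw [← Finset.sum_filter, Finset.sum_const, smul_eq_mul, mul_comm]
      refine Nat.mul_le_mul_left _ (Finset.card_le_card fun s hs => ?_)
      rw [Finset.mem_filter] at hs ⊢
      exact ⟨hs.2.2, hs.2.1⟩
    refine le_trans (le_of_eq ?_) ((Nat.add_le_add h1 ih).trans (occ_add_le_append _ _ hw))
    rw [← Finset.sum_add_distrib]
    refine Finset.sum_congr rfl fun s _ => ?_
    split_ifs <;> simp [label, *]

end Selected

/-! ### Asymptotics of the prescribed counts -/

/-- The number of positions at which a word of length `k` lies inside a block of multiplicity `i`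
selected up to step `k`. -/
noncomputable def roomCount (b : ℕ) (p : ℕ → ℝ) (k i : ℕ) : ℕ :=
  ∑ l ∈ Finset.range (k + 1), ∑ j ∈ Finset.Icc 1 (g l), blockCount b p l i j * (b ^ (l - j) + 1 - k)

section RoomCount

variable {b : ℕ} {p : ℕ → ℝ}

theorem roomCount_le (hb : 2 ≤ b) {k i : ℕ} (hk : 1 ≤ k) (hi : 1 ≤ i) (hp0 : 0 ≤ p i)
    (hp1 : p i < 1) : (roomCount b p k i : ℝ) ≤ p i * (b : ℝ) ^ k := by
  have h1 : roomCount b p k i ≤ ∑ l ∈ Finset.range (k + 1), stepLen b p l i :=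
    Finset.sum_le_sum fun l _ => Finset.sum_le_sum fun j _ => Nat.mul_le_mul_left _ (by omega)
  have h2 : ((b ^ k : ℕ) : ℝ) = (b : ℝ) ^ k := by push_cast; rfl
  rw [← h2, ← sum_layer hb hk, Nat.cast_sum, Finset.mul_sum]
  refine (Nat.cast_le.mpr h1).trans ?_
  rw [Nat.cast_sum]
  exact Finset.sum_le_sum fun l _ => stepLen_le hb l hi hp0 hp1

/-- A digit is at most `b` and a block loses fewer than `k` positions, so for fixed `i` the loss is
polynomial in `k`, apart from the truncation errors of the steps, each at most `b ^ (k / 2)`. -/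
theorem le_roomCount (hb : 2 ≤ b) {k i : ℕ} (hk : 1 ≤ k) (hi : 1 ≤ i) (hp0 : 0 ≤ p i)
    (hp1 : p i < 1) :
    p i * (b : ℝ) ^ k - (k + 1) * ((b : ℝ) ^ (k / 2) + b * k ^ 2) ≤ roomCount b p k i := by
  have hb1 : (1 : ℝ) ≤ b := by exact_mod_cast (by omega : 1 ≤ b)
  have h1 : ∀ l ∈ Finset.range (k + 1), p i * layer b l - ((b : ℝ) ^ (k / 2) + b * k ^ 2) ≤
      ((∑ j ∈ Finset.Icc 1 (g l), blockCount b p l i j * (b ^ (l - j) + 1 - k) : ℕ) : ℝ) := by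
    intro l hl
    have hlk : l ≤ k := Nat.lt_succ_iff.mp (Finset.mem_range.mp hl)
    have h2 : stepLen b p l i ≤
        (∑ j ∈ Finset.Icc 1 (g l), blockCount b p l i j * (b ^ (l - j) + 1 - k)) + k * (b * k) := by
      have h3 : ∑ _j ∈ Finset.Icc 1 (g l), b * k ≤ k * (b * k) := by
        rw [Finset.sum_const, Nat.card_Icc, smul_eq_mul]
        exact Nat.mul_le_mul_right _ (by have := g_le l; omega)
      refine le_trans ?_ (Nat.add_le_add_left h3 _)
      rw [← Finset.sum_add_distrib]
      refine Finset.sum_le_sum fun j _ => ?_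
      calc blockCount b p l i j * b ^ (l - j)
          ≤ blockCount b p l i j * ((b ^ (l - j) + 1 - k) + k) := Nat.mul_le_mul_left _ (by omega)
        _ ≤ _ := by
          rw [mul_add]
          exact Nat.add_le_add_left (Nat.mul_le_mul_right _ (blockCount_le hb _ _ _)) _
    have h4 : (stepLen b p l i : ℝ) ≤
        ((∑ j ∈ Finset.Icc 1 (g l), blockCount b p l i j * (b ^ (l - j) + 1 - k) : ℕ) : ℝ) +
          b * k ^ 2 := by
      refine (Nat.cast_le.mpr h2).trans (le_of_eq ?_)
      rw [Nat.cast_add, Nat.cast_mul, Nat.cast_mul]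
      ring
    have h5 := le_stepLen hb l hi hp0 hp1
    have h6 : (b : ℝ) ^ (l / 2) ≤ (b : ℝ) ^ (k / 2) :=
      pow_le_pow_right₀ hb1 (Nat.div_le_div_right hlk)
    linarith
  have h7 := Finset.sum_le_sum h1
  rw [Finset.sum_sub_distrib, ← Finset.mul_sum, ← Nat.cast_sum, ← Nat.cast_sum, sum_layer hb hk,
    Finset.sum_const, Finset.card_range, nsmul_eq_mul] at h7
  push_cast at h7
  unfold roomCount
  push_cast
  exact h7

theorem tendsto_roomCount_div (hb : 2 ≤ b) {i : ℕ} (hi : 1 ≤ i) (hp0 : 0 ≤ p i) (hp1 : p i < 1) :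
    Tendsto (fun k => (roomCount b p k i : ℝ) / (b : ℝ) ^ k) atTop (𝓝 (p i)) := by
  have hb1 : (1 : ℝ) < b := by exact_mod_cast (by omega : 1 < b)
  have hb0 : (0 : ℝ) < b := by linarith
  have hs1 : 1 < √(b : ℝ) := by rw [Real.lt_sqrt] <;> linarith
  have hs0 : 0 < √(b : ℝ) := by linarith
  have hr : |(√(b : ℝ))⁻¹| < 1 := by
    rw [abs_of_pos (by positivity)]
    exact inv_lt_one_of_one_lt₀ hs1
  have hr' : |(b : ℝ)⁻¹| < 1 := by
    rw [abs_of_pos (by positivity)]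
    exact inv_lt_one_of_one_lt₀ hb1
  -- The lower bound of `le_roomCount`, with `b ^ (k / 2) ≤ √b ^ k`, divided by `b ^ k`.
  have hlim : Tendsto (fun k : ℕ =>
      p i - (((k : ℝ) ^ 1 * (√(b : ℝ))⁻¹ ^ k + (k : ℝ) ^ 0 * (√(b : ℝ))⁻¹ ^ k) +
      b * ((k : ℝ) ^ 3 * (b : ℝ)⁻¹ ^ k + (k : ℝ) ^ 2 * (b : ℝ)⁻¹ ^ k))) atTop (𝓝 (p i)) := by
    have h1 := fun n => tendsto_pow_const_mul_const_pow_of_abs_lt_one n hr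
    have h2 := fun n => tendsto_pow_const_mul_const_pow_of_abs_lt_one n hr'
    simpa using tendsto_const_nhds.sub
      (((h1 1).add (h1 0)).add (((h2 3).add (h2 2)).const_mul (b : ℝ)))
  refine tendsto_of_tendsto_of_tendsto_of_le_of_le' hlim tendsto_const_nhds ?_ ?_
  · filter_upwards [eventually_ge_atTop 1] with k hk
    have hpow : (0 : ℝ) < (b : ℝ) ^ k := by positivity
    rw [le_div_iff₀ hpow]
    refine le_trans ?_ (le_roomCount hb hk hi hp0 hp1)
    have h1 : (b : ℝ) ^ (k / 2) ≤ √(b : ℝ) ^ k := by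
      calc (b : ℝ) ^ (k / 2) = √(b : ℝ) ^ (2 * (k / 2)) := by
            rw [pow_mul, Real.sq_sqrt hb0.le]
        _ ≤ √(b : ℝ) ^ k := pow_le_pow_right₀ hs1.le (Nat.mul_div_le k 2)
    have h2 : (√(b : ℝ))⁻¹ ^ k * (b : ℝ) ^ k = √(b : ℝ) ^ k := by
      rw [← mul_pow]
      congr 1
      rw [inv_mul_eq_div, Real.div_sqrt]
    have h3 : (b : ℝ)⁻¹ ^ k * (b : ℝ) ^ k = 1 := by
      rw [← mul_pow, inv_mul_cancel₀ hb0.ne', one_pow]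
    have h4 : (k + 1 : ℝ) * (b : ℝ) ^ (k / 2) ≤ (k + 1) * √(b : ℝ) ^ k := by gcongr
    have h5 : (p i - (((k : ℝ) ^ 1 * (√(b : ℝ))⁻¹ ^ k + (k : ℝ) ^ 0 * (√(b : ℝ))⁻¹ ^ k) +
        b * ((k : ℝ) ^ 3 * (b : ℝ)⁻¹ ^ k + (k : ℝ) ^ 2 * (b : ℝ)⁻¹ ^ k))) * (b : ℝ) ^ k =
        p i * (b : ℝ) ^ k - ((k + 1) * ((√(b : ℝ))⁻¹ ^ k * (b : ℝ) ^ k) +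
          b * (k ^ 3 + k ^ 2) * ((b : ℝ)⁻¹ ^ k * (b : ℝ) ^ k)) := by ring
    rw [h5, h2, h3]
    linarith
  · filter_upwards [eventually_ge_atTop 1] with k hk
    rw [div_le_iff₀ (by positivity)]
    exact roomCount_le hb hk hi hp0 hp1

end RoomCount

/-! ### Transfer of the distribution -/

theorem hasSum_mul_card_fiber {W : Type*} [Fintype W] (f : W → ℕ) (h : ℕ → ℝ) :
    HasSum (fun i => h i * ((Finset.univ.filter fun w => f w = i).card : ℝ)) (∑ w, h (f w)) := by
  have h1 := hasSum_sum (s := Finset.univ) fun (w : W) _ => hasSum_ite_eq (f w) (h (f w))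
  refine h1.congr_fun fun i => ?_
  rw [Finset.card_eq_sum_ones, Finset.sum_filter, Nat.cast_sum, Finset.mul_sum]
  refine Finset.sum_congr rfl fun w _ => ?_
  by_cases hw : f w = i
  · simp [hw]
  · simp [hw, Ne.symm hw]

theorem abs_card_fiber_sub_le {W : Type*} [Fintype W] {f F : W → ℕ} (hle : ∀ w, f w ≤ F w) (i : ℕ) :
    |((Finset.univ.filter fun w => F w = i).card : ℝ) -
      ((Finset.univ.filter fun w => f w = i).card : ℝ)| ≤ ∑ w, (F w : ℝ) - ∑ w, (f w : ℝ) := by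
  simp only [Finset.card_eq_sum_ones, Finset.sum_filter, Nat.cast_sum]
  rw [← Finset.sum_sub_distrib, ← Finset.sum_sub_distrib]
  refine (Finset.abs_sum_le_sum_abs _ _).trans (Finset.sum_le_sum fun w _ => ?_)
  rcases (hle w).eq_or_lt with h | h
  · simp [h]
  · have : (f w : ℝ) + 1 ≤ F w := by exact_mod_cast h
    split_ifs <;> simp <;> linarith

/-- Let `f ≤ F` be counting functions on finite sets of size `M k`. If `f` has the
proportions `p i` in the limit, with domination, and the total of `F` is at most `lam * M k`,
where `lam` is the mean of `p`, then no mass is left for `F - f`, and `F` has the same limit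
proportions. -/
theorem tendsto_card_fiber_div {W : ℕ → Type*} [∀ k, Fintype (W k)] {f F : ∀ k, W k → ℕ}
    {p : ℕ → ℝ} {lam : ℝ} {M : ℕ → ℝ} (hM : ∀ k, 0 < M k)
    (hcard : ∀ k, (Fintype.card (W k) : ℝ) = M k)
    (hsum : HasSum p 1) (hmean : HasSum (fun i : ℕ => (i : ℝ) * p i) lam)
    (hle : ∀ᶠ k in atTop, ∀ w, f k w ≤ F k w)
    (hF : ∀ᶠ k in atTop, ∑ w, (F k w : ℝ) ≤ lam * M k)
    (hdom : ∀ᶠ k in atTop, ∀ i, 1 ≤ i →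
      ((Finset.univ.filter fun w => f k w = i).card : ℝ) ≤ p i * M k)
    (hlim : ∀ i, 1 ≤ i → Tendsto
      (fun k => ((Finset.univ.filter fun w => f k w = i).card : ℝ) / M k) atTop (𝓝 (p i))) (i : ℕ) :
    Tendsto (fun k => ((Finset.univ.filter fun w => F k w = i).card : ℝ) / M k) atTop (𝓝 (p i)) := by
  -- Tannery's theorem for weights `h i` that vanish at `i = 0`.
  have key : ∀ (h : ℕ → ℝ), h 0 = 0 → (∀ i, 0 ≤ h i) → Summable (fun i => h i * p i) →
      Tendsto (fun k => (∑ w, h (f k w)) / M k) atTop (𝓝 (∑' i, h i * p i)) := by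
    intro h h0 hpos hsm
    have h1 : ∀ k, (∑ w, h (f k w)) / M k =
        ∑' i, h i * (((Finset.univ.filter fun w => f k w = i).card : ℝ) / M k) := by
      intro k
      rw [← ((hasSum_mul_card_fiber (f k) h).div_const (M k)).tsum_eq]
      simp only [mul_div_assoc]
    simp only [h1]
    refine tendsto_tsum_of_dominated_convergence hsm (fun i => ?_) ?_
    · rcases Nat.eq_zero_or_pos i with rfl | hi
      · simp [h0]
      · exact (hlim i hi).const_mul _
    · filter_upwards [hdom] with k hk i
      rcases Nat.eq_zero_or_pos i with rfl | hi
      · simp [h0]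
      · rw [Real.norm_of_nonneg
          (mul_nonneg (hpos i) (div_nonneg (Nat.cast_nonneg _) (hM k).le))]
        exact mul_le_mul_of_nonneg_left ((div_le_iff₀ (hM k)).mpr (hk i hi)) (hpos i)
  have htotal : Tendsto (fun k => (∑ w, (f k w : ℝ)) / M k) atTop (𝓝 lam) := by
    have := key (fun i => (i : ℝ)) Nat.cast_zero (fun i => Nat.cast_nonneg i) hmean.summable
    rwa [hmean.tsum_eq] at this
  have hall : Tendsto (fun k => ((Finset.univ.filter fun w => f k w = i).card : ℝ) / M k) atTop
      (𝓝 (p i)) := by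
    rcases Nat.eq_zero_or_pos i with rfl | hi
    · have h1 : HasSum (fun i => (if i = 0 then 0 else 1) * p i) (1 - p 0) := by
        refine (hsum.sub (hasSum_ite_eq 0 (p 0))).congr_fun fun i => ?_
        split_ifs with h <;> simp [h]
      have h2 := key (fun i => if i = 0 then 0 else 1) (if_pos rfl)
        (fun i => by split_ifs <;> norm_num) h1.summable
      rw [h1.tsum_eq] at h2
      have h3 := h2.const_sub 1
      rw [sub_sub_cancel] at h3
      refine h3.congr fun k => ?_
      have h4 : (∑ w, (if f k w = 0 then (0 : ℝ) else 1)) +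
          ((Finset.univ.filter fun w => f k w = 0).card : ℝ) = M k := by
        rw [← hcard, Finset.card_eq_sum_ones, Finset.sum_filter, Nat.cast_sum,
          ← Finset.sum_add_distrib, ← Finset.card_univ, Finset.card_eq_sum_ones, Nat.cast_sum]
        refine Finset.sum_congr rfl fun w _ => ?_
        split_ifs <;> simp
      rw [eq_div_iff (hM k).ne', sub_mul, one_mul, div_mul_cancel₀ _ (hM k).ne']
      linarith
    · exact hlim i hi
  have hdiff : Tendsto (fun k => ((Finset.univ.filter fun w => F k w = i).card : ℝ) / M k -
      ((Finset.univ.filter fun w => f k w = i).card : ℝ) / M k) atTop (𝓝 0) := by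
    refine squeeze_zero_norm' (a := fun k => lam - (∑ w, (f k w : ℝ)) / M k) ?_ ?_
    · filter_upwards [hle, hF] with k h1 h2
      rw [← sub_div, Real.norm_eq_abs, abs_div, abs_of_pos (hM k), div_le_iff₀ (hM k), sub_mul,
        div_mul_cancel₀ _ (hM k).ne']
      exact (abs_card_fiber_sub_le h1 i).trans (by linarith)
    · simpa using htotal.const_sub lam
  simpa using hdiff.add hall

/-! ### The Poisson distribution -/

section Poisson

variable {lam : ℝ}

theorem poissonMass_pos (hlam : 0 < lam) (i : ℕ) : 0 < poissonMass lam i := by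
  unfold poissonMass
  positivity

theorem hasSum_poissonMass (lam : ℝ) : HasSum (poissonMass lam) 1 := by
  have h1 := (NormedSpace.expSeries_div_hasSum_exp lam).mul_left (Real.exp (-lam))
  rw [← Real.exp_eq_exp_ℝ, ← Real.exp_add, neg_add_cancel, Real.exp_zero] at h1
  exact h1.congr_fun fun i => by rw [poissonMass, mul_div_assoc]

theorem hasSum_mul_poissonMass (lam : ℝ) :
    HasSum (fun i : ℕ => (i : ℝ) * poissonMass lam i) lam := by
  rw [← hasSum_nat_add_iff' 1]
  have h1 := (hasSum_poissonMass lam).mul_left lam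
  rw [mul_one] at h1
  simp only [Finset.sum_range_one, Nat.cast_zero, zero_mul, sub_zero]
  refine h1.congr_fun fun i => ?_
  unfold poissonMass
  rw [Nat.factorial_succ, pow_succ]
  push_cast
  have : (i.factorial : ℝ) ≠ 0 := by exact_mod_cast i.factorial_ne_zero
  field_simp

theorem poissonMass_lt_one (hlam : 0 < lam) (i : ℕ) : poissonMass lam i < 1 := by
  have h1 := sum_le_hasSum {i, i + 1} (fun j _ => (poissonMass_pos hlam j).le)
    (hasSum_poissonMass lam)
  rw [Finset.sum_pair (Nat.succ_ne_self i).symm] at h1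
  linarith [poissonMass_pos hlam (i + 1)]

end Poisson

/-! ### The output of the construction -/

section Output

variable {Ω : Type*}

/-- An infinite word with given finite prefixes, each of which extends the previous one. -/
theorem exists_forall_eq_pref {o : ℕ → List Ω} (ho : ∀ k, o k <+: o (k + 1))
    (hlen : Tendsto (fun k => (o k).length) atTop atTop) :
    ∃ x : ℕ → Ω, ∀ k, o k = pref x (o k).length := by
  have hmono : ∀ k l, k ≤ l → o k <+: o l := fun k l hkl => by
    induction l, hkl using Nat.le_induction with
    | base => exact List.prefix_rfl
    | succ l _ ih => exact ih.trans (ho l)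
  have hex : ∀ m, ∃ k, m < (o k).length := fun m => (hlen.eventually_gt_atTop m).exists
  choose K hK using hex
  refine ⟨fun m => (o (K m))[m]'(hK m), fun k => ?_⟩
  apply List.ext_getElem
  · simp [pref]
  · intro m h1 _
    simp only [pref, List.getElem_map, List.getElem_range]
    rcases le_total k (K m) with h | h
    · exact (hmono _ _ h).getElem h1
    · exact ((hmono _ _ h).getElem (hK m)).symm

theorem pref_append (x : ℕ → Ω) {m n : ℕ} (h : m ≤ n) : ∃ v, pref x n = pref x m ++ v := by
  obtain ⟨r, rfl⟩ := Nat.exists_eq_add_of_le h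
  exact ⟨_, by simp only [pref]; rw [List.range_add, List.map_append]⟩

variable [Fintype Ω]

theorem length_run (A : ℕ → Ω) (k : ℕ) (B : Block) :
    (run A k B).length = B.mult * B.len (Fintype.card Ω) k := by
  simp [run, segment]

theorem length_output (A : ℕ → Ω) (S : ℕ → List Block) (k : ℕ) :
    (output A S k).length =
      ((selected S k).map fun q => q.2.mult * q.2.len (Fintype.card Ω) q.1).sum := by
  rw [output_eq_flatMap, List.length_flatMap]
  simp only [length_run]

variable {b : ℕ} {p : ℕ → ℝ} {S : ℕ → List Block}

theorem sum_room_selected (hS : ∀ k, ValidStep b p S k) {k i : ℕ} (hi : 1 ≤ i) :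
    ((selected S k).map fun q => if q.2.mult = i then q.2.len b q.1 + 1 - k else 0).sum =
      roomCount b p k i := by
  rw [sum_selected (hS 0).eq_nil fun l B => if B.mult = i then B.len b l + 1 - k else 0]
  exact Finset.sum_congr rfl fun l _ =>
    (hS l).hasCounts.sum_map_ite hi fun j => b ^ (l - j) + 1 - k

theorem HasCounts.sum_mult_mul_len_le {k : ℕ} {L : List Block} {lam : ℝ} (hb : 2 ≤ b)
    (hp0 : ∀ i, 0 ≤ p i) (hp1 : ∀ i, p i < 1) (hmean : HasSum (fun i : ℕ => (i : ℝ) * p i) lam)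
    (h : HasCounts b p k L) :
    (((L.map fun B => B.mult * B.len b k).sum : ℕ) : ℝ) ≤ lam * layer b k := by
  obtain ⟨I, hI⟩ := exists_forall_mult_lt L
  have h1 : (L.map fun B => B.mult * B.len b k).sum =
      ∑ i ∈ Finset.Ico 1 I, i * stepLen b p k i := by
    have := h.sum_map hI fun i j => i * b ^ (k - j)
    simp only [mul_left_comm _ _ (_ ^ _), ← Finset.mul_sum] at this
    exact this
  rw [h1, Nat.cast_sum]
  calc ∑ i ∈ Finset.Ico 1 I, ((i * stepLen b p k i : ℕ) : ℝ)
      ≤ ∑ i ∈ Finset.Ico 1 I, (i : ℝ) * p i * layer b k := by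
        refine Finset.sum_le_sum fun i hi => ?_
        rw [Nat.cast_mul, mul_assoc]
        exact mul_le_mul_of_nonneg_left
          (stepLen_le hb k (Finset.mem_Ico.mp hi).1 (hp0 i) (hp1 i)) (Nat.cast_nonneg i)
    _ ≤ lam * layer b k := by
        rw [← Finset.sum_mul]
        exact mul_le_mul_of_nonneg_right
          (sum_le_hasSum _ (fun i _ => mul_nonneg (Nat.cast_nonneg i) (hp0 i)) hmean)
          (Nat.cast_nonneg _)

theorem length_output_le {lam : ℝ} (A : ℕ → Ω) (hb : 2 ≤ Fintype.card Ω) (hp0 : ∀ i, 0 ≤ p i)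
    (hp1 : ∀ i, p i < 1) (hmean : HasSum (fun i : ℕ => (i : ℝ) * p i) lam)
    (hS : ∀ k, ValidStep (Fintype.card Ω) p S k) {k : ℕ} (hk : 1 ≤ k) :
    ((output A S k).length : ℝ) ≤ lam * (Fintype.card Ω : ℝ) ^ k := by
  rw [length_output,
    sum_selected (hS 0).eq_nil (fun l B => B.mult * B.len (Fintype.card Ω) l)]
  have h1 : ((Fintype.card Ω ^ k : ℕ) : ℝ) = (Fintype.card Ω : ℝ) ^ k := by push_cast; rfl
  rw [← h1, ← sum_layer hb hk, Nat.cast_sum, Nat.cast_sum, Finset.mul_sum]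
  exact Finset.sum_le_sum fun l _ => (hS l).hasCounts.sum_mult_mul_len_le hb hp0 hp1 hmean

theorem tendsto_length_output (A : ℕ → Ω) (hb : 2 ≤ Fintype.card Ω) (hp0 : 0 < p 1)
    (hp1 : p 1 < 1) (hS : ∀ k, ValidStep (Fintype.card Ω) p S k) :
    Tendsto (fun k => (output A S k).length) atTop atTop := by
  have hb1 : (1 : ℝ) < (Fintype.card Ω : ℝ) := by exact_mod_cast (by omega : 1 < Fintype.card Ω)
  have h1 := (tendsto_roomCount_div hb le_rfl hp0.le hp1).pos_mul_atTop hp0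
    (tendsto_pow_atTop_atTop_of_one_lt hb1)
  refine tendsto_atTop_mono' _ (f₁ := fun k => roomCount (Fintype.card Ω) p k 1) ?_
    (tendsto_natCast_atTop_iff.mp (h1.congr fun k => ?_))
  · filter_upwards [eventually_ge_atTop 1] with k hk
    rw [length_output, ← sum_room_selected hS le_rfl]
    refine List.sum_le_sum fun q _ => ?_
    split_ifs with h
    · rw [h, one_mul]
      omega
    · exact Nat.zero_le _
  · rw [div_mul_cancel₀]
    positivity

theorem exists_isLimitOutput (A : ℕ → Ω) (hb : 2 ≤ Fintype.card Ω) (hp0 : 0 < p 1)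
    (hp1 : p 1 < 1) (hS : ∀ k, ValidStep (Fintype.card Ω) p S k) :
    ∃ x : ℕ → Ω, IsLimitOutput A S x := by
  have hlen := tendsto_length_output A hb hp0 hp1 hS
  obtain ⟨x, hx⟩ := exists_forall_eq_pref (o := output A S) (fun k => List.prefix_append _ _) hlen
  exact ⟨x, hx, hlen⟩

/-- In the blocks selected up to step `k` no word of length `k` occurs twice. For `b = 2` and `k`
even this uses that the blocks lie in the first `2^(k-1)` positions, which form a de Bruijn word
of order `k - 1`. -/
theorem window_injective_on_rooms {A : ℕ → Ω} (hb : 2 ≤ Fintype.card Ω) (hp0 : ∀ i, 0 ≤ p i)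
    (hp1 : ∀ i, p i < 1) (hsum : HasSum p 1) (hhalf : Fintype.card Ω = 2 → 1 / 2 ≤ p 0)
    (hA : IsInfiniteDeBruijn A) (hS : ∀ k, ValidStep (Fintype.card Ω) p S k) {k : ℕ} (hk : 1 ≤ k)
    {q r : ℕ × Block} (hq : q ∈ selected S k) (hr : r ∈ selected S k) {s t : ℕ}
    (hs : s ∈ room (Fintype.card Ω) k q) (ht : t ∈ room (Fintype.card Ω) k r)
    (h : window A k s = window A k t) : s = t := by
  have hs' := add_le_of_mem_room hs
  have ht' := add_le_of_mem_room ht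
  unfold IsInfiniteDeBruijn at hA
  split_ifs at hA with h2
  · have hodd : ∀ m, 1 ≤ m →
        IsCyclicDeBruijn (2 * m - 1) (pref A (Fintype.card Ω ^ (2 * m - 1))) := by
      simpa only [h2] using hA
    rcases Nat.even_or_odd' k with ⟨m, rfl | rfl⟩
    · have h3 := hodd m (by omega)
      have h4 := end_le_half_of_mem_selected h2 hp0 hp1 hsum (hhalf h2) hS hq
      have h5 := end_le_half_of_mem_selected h2 hp0 hp1 hsum (hhalf h2) hS hr
      exact h3.injective_window hb (by omega) (by omega) (by omega)
        (window_eq_of_le (Nat.sub_le _ _) h)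
    · have h3 := hodd (m + 1) (by omega)
      rw [show 2 * (m + 1) - 1 = 2 * m + 1 by omega] at h3
      exact h3.injective_window hb hk (hs'.trans (end_le_of_mem_selected hb hS hq))
        (ht'.trans (end_le_of_mem_selected hb hS hr)) h
  · exact (hA k hk).injective_window hb hk (hs'.trans (end_le_of_mem_selected hb hS hq))
      (ht'.trans (end_le_of_mem_selected hb hS hr)) h

variable [DecidableEq Ω]

/-- The number of occurrences of `w` in the output after step `k` that lie inside a copy of a
block, each position of the source counted with the multiplicity of its block. -/
def innerCount (A : ℕ → Ω) (S : ℕ → List Block) (k : ℕ) (w : Fin k → Ω) : ℕ :=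
  ∑ s ∈ Finset.range (Fintype.card Ω ^ k), if window A k s = w then
    label (room (Fintype.card Ω) k) (fun q => q.2.mult) (selected S k) s else 0

theorem card_innerCount_eq {A : ℕ → Ω} (hb : 2 ≤ Fintype.card Ω) (hp0 : ∀ i, 0 ≤ p i)
    (hp1 : ∀ i, p i < 1) (hsum : HasSum p 1) (hhalf : Fintype.card Ω = 2 → 1 / 2 ≤ p 0)
    (hA : IsInfiniteDeBruijn A) (hS : ∀ k, ValidStep (Fintype.card Ω) p S k) {k i : ℕ}
    (hk : 1 ≤ k) (hi : 1 ≤ i) :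
    (Finset.univ.filter fun w => innerCount A S k w = i).card =
      roomCount (Fintype.card Ω) p k i := by
  unfold innerCount
  rw [card_fiber_sum_eq _ _ _ (fun s t hs ht h => ?_) hi, card_label_eq _ _ hi,
    ← sum_room_selected hS hi]
  · simp only [card_room]
  · refine (pairwise_disjoint_selected hS k).imp fun {q r} h => ?_
    exact h.mono (room_subset hk q) (room_subset hk r)
  · intro q hq s hs
    have h1 := add_le_of_mem_room hs
    have h2 := end_le_of_mem_selected hb hS hq
    exact Finset.mem_range.mpr (by omega)
  · obtain ⟨q, hq, hsq⟩ := exists_mem_of_label_ne_zero hs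
    obtain ⟨r, hr, htr⟩ := exists_mem_of_label_ne_zero ht
    exact window_injective_on_rooms hb hp0 hp1 hsum hhalf hA hS hk hq hr hsq htr h

theorem innerCount_le_occ {A x : ℕ → Ω} (hx : IsLimitOutput A S x) {k M : ℕ} (hk : 1 ≤ k)
    (hM : (output A S k).length ≤ M) (w : Fin k → Ω) :
    innerCount A S k w ≤ occ (pref x M) (List.ofFn w) := by
  have hw : List.ofFn w ≠ [] := by
    rw [← List.length_pos_iff, List.length_ofFn]
    exact hk
  obtain ⟨v, hv⟩ := pref_append x hM
  rw [hv, ← hx.1 k]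
  refine le_trans ?_ (le_trans (Nat.le_add_right _ _) (occ_add_le_append _ v hw))
  rw [output_eq_flatMap]
  exact sum_label_le_occ A hk w _ _

theorem isPoissonGeneric_of_isLimitOutput {A x : ℕ → Ω} {lam : ℝ} (hb : 2 ≤ Fintype.card Ω)
    (hlam : 0 < lam) (hlam2 : Fintype.card Ω = 2 → lam ≤ Real.log 2) (hA : IsInfiniteDeBruijn A)
    (hS : ∀ k, ValidStep (Fintype.card Ω) (poissonMass lam) S k) (hx : IsLimitOutput A S x) :
    IsPoissonGeneric lam x := by
  have hp0 : ∀ i, 0 ≤ poissonMass lam i := fun i => (poissonMass_pos hlam i).le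
  have hp1 := poissonMass_lt_one hlam
  have hsum := hasSum_poissonMass lam
  have hmean := hasSum_mul_poissonMass lam
  have hhalf : Fintype.card Ω = 2 → 1 / 2 ≤ poissonMass lam 0 := fun h => by
    have h1 : Real.exp (-Real.log 2) ≤ Real.exp (-lam) :=
      Real.exp_le_exp.mpr (neg_le_neg (hlam2 h))
    rw [Real.exp_neg, Real.exp_log two_pos] at h1
    simpa [poissonMass] using h1
  have hpow : ∀ k : ℕ, (0 : ℝ) < (Fintype.card Ω : ℝ) ^ k := fun k =>
    pow_pos (by exact_mod_cast (by omega : 0 < Fintype.card Ω)) k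
  intro i
  unfold Z
  refine tendsto_card_fiber_div (W := fun k => Fin k → Ω) (f := fun k => innerCount A S k)
    (F := fun k w => occ (pref x (⌊lam * (Fintype.card Ω : ℝ) ^ k⌋₊ + k - 1)) (List.ofFn w))
    hpow (fun k => by simp) hsum hmean ?_ ?_ ?_ (fun i hi => ?_) i
  · filter_upwards [eventually_ge_atTop 1] with k hk w
    refine innerCount_le_occ hx hk ?_ w
    have := Nat.le_floor (length_output_le A hb hp0 hp1 hmean hS hk)
    omega
  · filter_upwards [eventually_ge_atTop 1] with k hk
    rw [← Nat.cast_sum, sum_occ_pref]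
    refine le_trans (Nat.cast_le.mpr ?_) (Nat.floor_le (mul_pos hlam (hpow k)).le)
    omega
  · filter_upwards [eventually_ge_atTop 1] with k hk i hi
    rw [card_innerCount_eq hb hp0 hp1 hsum hhalf hA hS hk hi]
    exact roomCount_le hb hk hi (hp0 i) (hp1 i)
  · refine (tendsto_roomCount_div hb hi (hp0 i) (hp1 i)).congr' ?_
    filter_upwards [eventually_ge_atTop 1] with k hk
    rw [card_innerCount_eq hb hp0 hp1 hsum hhalf hA hS hk hi]

end Output
end PoissonGeneric

theorem corollary1 {Ω : Type*} [Fintype Ω] [DecidableEq Ω] (hb : 2 ≤ Fintype.card Ω)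
    (lam : ℝ) (hlam : 0 < lam) (hlam2 : Fintype.card Ω = 2 → lam ≤ Real.log 2) :
    -- a source sequence for the construction exists
    (∃ A : ℕ → Ω, PoissonGeneric.IsInfiniteDeBruijn A) ∧
    -- the construction never gets stuck: any valid first steps extend to a complete selection
    (∀ (n : ℕ) (S : ℕ → List PoissonGeneric.Block),
      (∀ k < n, PoissonGeneric.ValidStep (Fintype.card Ω) (PoissonGeneric.poissonMass lam) S k) →
      ∃ T : ℕ → List PoissonGeneric.Block, (∀ k < n, T k = S k) ∧
        ∀ k, PoissonGeneric.ValidStep (Fintype.card Ω) (PoissonGeneric.poissonMass lam) T k) ∧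
    -- whatever the choices, the output is an infinite sequence that is Poisson generic
    (∀ A : ℕ → Ω, PoissonGeneric.IsInfiniteDeBruijn A →
      ∀ S : ℕ → List PoissonGeneric.Block,
        (∀ k, PoissonGeneric.ValidStep (Fintype.card Ω) (PoissonGeneric.poissonMass lam) S k) →
        ∃ x : ℕ → Ω, PoissonGeneric.IsLimitOutput A S x ∧
          PoissonGeneric.IsPoissonGeneric lam x) := by
  have hp0 : ∀ i, 0 ≤ PoissonGeneric.poissonMass lam i := fun i =>
    (PoissonGeneric.poissonMass_pos hlam i).le
  have hp1 := PoissonGeneric.poissonMass_lt_one hlam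
  refine ⟨PoissonGeneric.exists_isInfiniteDeBruijn hb,
    PoissonGeneric.exists_continuation hb hp0 hp1 (PoissonGeneric.hasSum_poissonMass lam),
    fun A hA S hS => ?_⟩
  obtain ⟨x, hx⟩ := PoissonGeneric.exists_isLimitOutput A hb
    (PoissonGeneric.poissonMass_pos hlam 1) (hp1 1) hS
  exact ⟨x, hx, PoissonGeneric.isPoissonGeneric_of_isLimitOutput hb hlam hlam2 hA hS hx⟩
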